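/- Let $R$ be a commutative ring and let $G$ be a finite directed graph (edges form a subset of $V(G)\times V(G)$). Let $d_G(x,y)\in\mathbb N\cup\{\infty\}$ be the minimal number of edges of a directed path from $x$ to $y$, and put $\mathrm{len}(x_0,\dots,x_k)=\sum_{i<k} d_G(x_i,x_{i+1})$. Definitions. * $\mathbf{Reach}_G$ is the category whose objects are the vertices of $G$, with exactly one morphism $x\to y$ if there is a (possibly constant) directed path from $x$ to $y$, and none otherwise. $N(\mathbf{Reach}_G)$ is its nerve, and the injective nerve $N^\iota(\mathbf{Reach}_G)\subseteq N(\mathbf{Reach}_G)$ is the simplicial subset consisting of the functors $[m]\to\mathbf{Reach}_G$ that are injective on objects and all their degeneracies. Both are filtered by $F_\ell$ = the simplices $(x_0,\dots,x_k)$ with $\mathrm{len}(x_0,\dots,x_k)\le\ell$, and their normalized chain complexes over $R$ are filtered by the images of the normalized chains of $F_\ell$. The spectral sequences of these filtered complexes are the regular magnitude-path spectral sequence $IE$ and the magnitude-path spectral sequence $E$. Here $IE^{\ell,r}_k$ denotes the term on page $r\ge 0$ in filtration degree $\ell$ and chain degree $k$, with differential $IE^{\ell,r}_k\to IE^{\ell-r,r}_{k-1}$;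 explicitly $IE^{\ell,r}_k=Z^r_\ell/(Z^{r-1}_{\ell-1}+\partial Z^{r-1}_{\ell+r-1})$ with $Z^r_\ell=\{x\in F_\ell : \partial x\in F_{\ell-r}\}$. * $\mathrm{EMC}_{k,\ell}(G)$ is the free $R$-module on the tuples $(x_0,\dots,x_k)$ of pairwise distinct vertices with $\mathrm{len}=\ell$, with differential $\sum_{i=1}^{k-1}(-1)^i\partial_i$, where $\partial_i$ omits $x_i$ if this preserves the length and is $0$ otherwise. $\mathrm{EMH}_{k,\ell}(G)=H_k(\mathrm{EMC}_{*,\ell}(G))$ is the eulerian magnitude homology. * Let $\mathcal A^\iota_k$ be the free $R$-module on the tuples $(x_0,\dots,x_k)$ of pairwise distinct vertices such that each $(x_i,x_{i+1})$ is an edge, let $\partial=\sum_{i=0}^k(-1)^i\partial_i$ be the usual boundary on tuples, and let $\Omega^\iota_k=\{u\in\mathcal A^\iota_k : \partial u\in\mathcal A^\iota_{k-1}\}$ (with $\Omega^\iota_0=\mathcal A^\iota_0$). The regular path homology of $G$ is $H_k(\Omega^\iota_*,\partial)$. * $\mathrm{Inj}(G)$, the complex of injective words on $G$, has as $k$-simplices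 the words $x_0\cdots x_k$ of pairwise distinct vertices such that for all $i<j$ there is a directed path from $x_i$ to $x_j$; the faces omit letters. Its homology (over $R$) is that of the free $R$-modules on these words with $\partial=\sum_{i=0}^k(-1)^i\partial_i$. Theorem. 1. For all $k,\ell\ge0$ there is an isomorphism $\mathrm{EMH}_{k,\ell}(G)\cong IE^{\ell,1}_k$, sending the class of a cycle of tuples to the class of the corresponding chain of simplices. 2. For all $k\ge0$ there is an isomorphism between the regular path homology of $G$ in degree $k$ and the diagonal term $IE^{k,2}_k$ of the second page, sending the class of a cycle to the class of the corresponding chain of simplices. 3. The map sending an injective word to the corresponding simplex is an isomorphism from the chain complex of $\mathrm{Inj}(G)$ to the normalized chain complex of $N^\iota(\mathbf{Reach}_G)$, and the spectral sequence $IE$ converges to the homology of $\mathrm{Inj}(G)$. That is, let $\Phi_\ell H_k(\mathrm{Inj}(G))$ be the submodule of the classes represented by cycles of words of length at most $\ell$. This increasing filtration is zero for $\ell<0$ and is all of $H_k(\mathrm{Inj}(G))$ for large $\ell$; for all $\ell,k\ge 0$ the differentials into and out of $IE^{\ell,r}_k$ vanish for all sufficiently large $r$, and the stable value satisfies $IE^{\ell,\infty}_k\cong\Phi_\ell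 H_k(\mathrm{Inj}(G))/\Phi_{\ell-1}H_k(\mathrm{Inj}(G))$. 4. The inclusions $F_\ell N^\iota(\mathbf{Reach}_G)\subseteq F_\ell N(\mathbf{Reach}_G)$ induce a morphism of spectral sequences from $IE$ to the magnitude-path spectral sequence $E$. -/

import Mathlib

open CategoryTheory

universe u

/-- If `φ : Z → S.X₂` takes values in the cycles, hits every homology class, and `N` consists of the
elements which `φ` sends to boundaries, then the homology of `S` is `Z ⧸ N`. The inverse of this
isomorphism sends the class of `z` to the homology class of the cycle `φ z`. -/
noncomputable def ShortComplex.homologyIsoQuotient {R : Type u} [CommRing R]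
    (S : ShortComplex (ModuleCat.{u} R)) {Z : Type u} [AddCommGroup Z] [Module R Z]
    (N : Submodule R Z) (φ : Z →ₗ[R] S.X₂) (h₁ : ∀ z, S.g (φ z) = 0)
    (h₂ : ∀ x, S.g x = 0 → ∃ z y, x = φ z + S.f y)
    (h₃ : ∀ z, z ∈ N ↔ ∃ y, S.f y = φ z) :
    S.homology ≅ ModuleCat.of R (Z ⧸ N) :=
  let ψ : ModuleCat.of R Z ⟶ S.homology :=
    S.liftCycles (ModuleCat.ofHom φ) (by ext z; exact h₁ z) ≫ S.homologyπ
  have hφ : ∀ z, S.iCycles (S.liftCycles (ModuleCat.ofHom φ) (by ext z; exact h₁ z) z) = φ z :=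
    fun z => by
      rw [← ConcreteCategory.comp_apply, S.liftCycles_i]; rfl
  have hinj : Function.Injective S.iCycles := (ModuleCat.mono_iff_injective _).1 inferInstance
  have hf : ∀ y, S.iCycles (S.toCycles y) = S.f y := fun y => by
    rw [← ConcreteCategory.comp_apply, S.toCycles_i]
  have hπf : ∀ y, S.homologyπ (S.toCycles y) = 0 := fun y => by
    rw [← ConcreteCategory.comp_apply, S.toCycles_comp_homologyπ]; rfl
  have hex : ∀ c, S.homologyπ c = 0 → ∃ y, S.toCycles y = c := by
    have := (ShortComplex.exact_of_g_is_cokernel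
      (ShortComplex.mk S.toCycles S.homologyπ S.toCycles_comp_homologyπ) S.homologyIsCokernel)
    exact (ShortComplex.moduleCat_exact_iff _).1 this
  have hsurj : Function.Surjective ψ.hom := by
    intro h
    obtain ⟨c, rfl⟩ := (ModuleCat.epi_iff_surjective S.homologyπ).1 inferInstance h
    obtain ⟨z, y, hz⟩ := h₂ (S.iCycles c) (by
      rw [← ConcreteCategory.comp_apply, S.iCycles_g]; rfl)
    refine ⟨z, ?_⟩
    have : c = S.liftCycles (ModuleCat.ofHom φ) (by ext z; exact h₁ z) z + S.toCycles y := by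
      apply hinj
      rw [map_add, hφ, hf, hz]
    rw [this, map_add, hπf, add_zero]
    rfl
  have hker : N = LinearMap.ker ψ.hom := by
    ext z
    rw [h₃, LinearMap.mem_ker]
    constructor
    · rintro ⟨y, hy⟩
      have : S.liftCycles (ModuleCat.ofHom φ) (by ext z; exact h₁ z) z = S.toCycles y := by
        apply hinj
        rw [hφ, hf, hy]
      change S.homologyπ (S.liftCycles (ModuleCat.ofHom φ) _ z) = 0
      rw [this, hπf]
    · intro h
      obtain ⟨y, hy⟩ := hex _ h
      exact ⟨y, by rw [← hf, hy]; exact hφ z⟩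
  ((Submodule.quotEquivOfEq _ _ hker).trans
    (ψ.hom.quotKerEquivOfSurjective hsurj)).toModuleIso.symm

/-- A chain complex of `R`-modules with an increasing filtration by subcomplexes which vanishes in
negative filtration degrees. -/
structure FilteredComplex (R : Type u) [CommRing R] where
  C : ChainComplex (ModuleCat.{u} R) ℕ
  F : ℤ → ∀ k : ℕ, Submodule R (C.X k)
  mono : ∀ {p q : ℤ}, p ≤ q → ∀ k, F p k ≤ F q k
  d_mem : ∀ (p : ℤ) (i j : ℕ) (x : C.X i), x ∈ F p i → C.d i j x ∈ F p j
  neg : ∀ (p : ℤ) (k : ℕ), p < 0 → F p k = ⊥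

namespace FilteredComplex

variable {R : Type u} [CommRing R]

/-- `Z^r_p = {x ∈ F_p C_k | dx ∈ F_{p-r} C_{k-1}}` (no condition on `dx` if `k = 0`). -/
def Z (A : FilteredComplex R) (r p : ℤ) (k : ℕ) : Submodule R (A.C.X k) where
  carrier := {x | x ∈ A.F p k ∧ ∀ j, A.C.d k j x ∈ A.F (p - r) j}
  add_mem' {x y} hx hy := ⟨add_mem hx.1 hy.1, fun j => by
    rw [map_add]; exact add_mem (hx.2 j) (hy.2 j)⟩
  zero_mem' := ⟨zero_mem _, fun j => by rw [map_zero]; exact zero_mem _⟩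
  smul_mem' a x hx := ⟨Submodule.smul_mem _ a hx.1, fun j => by
    rw [map_smul]; exact Submodule.smul_mem _ a (hx.2 j)⟩

/-- `B^r_p = Z^{r-1}_{p-1} + d Z^{r-1}_{p+r-1}`. -/
def B (A : FilteredComplex R) (r p : ℤ) (k : ℕ) : Submodule R (A.C.X k) :=
  A.Z (r - 1) (p - 1) k ⊔ (A.Z (r - 1) (p + r - 1) (k + 1)).map (A.C.d (k + 1) k).hom

/-- `E^r_{p,k} = Z^r_p / B^r_p`; here `p` is the filtration degree and `k` the chain degree. -/
abbrev E (A : FilteredComplex R) (r p : ℤ) (k : ℕ) : Type u :=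
  A.Z r p k ⧸ (A.B r p k).comap (A.Z r p k).subtype

/-- The class in `E^r_{p,k}` of an element of `Z^r_p`. -/
abbrev cls (A : FilteredComplex R) (r p : ℤ) (k : ℕ) : A.Z r p k →ₗ[R] A.E r p k :=
  Submodule.mkQ _

lemma d_d (A : FilteredComplex R) (i j l : ℕ) (x : A.C.X i) : A.C.d j l (A.C.d i j x) = 0 := by
  rw [← ConcreteCategory.comp_apply, A.C.d_comp_d]; rfl

lemma d_mem_Z (A : FilteredComplex R) {r p q : ℤ} {i j : ℕ} (h : p - r = q)
    {x : A.C.X i} (hx : x ∈ A.Z r p i) (s : ℤ) : A.C.d i j x ∈ A.Z s q j :=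
  ⟨h ▸ hx.2 j, fun l => by rw [A.d_d]; exact zero_mem _⟩

lemma d_mem_B (A : FilteredComplex R) {r p q : ℤ} {i j : ℕ} (h : p - r = q)
    {x : A.C.X i} (hx : x ∈ A.B r p i) : A.C.d i j x ∈ A.B r q j := by
  obtain ⟨y, hy, z, ⟨w, -, rfl⟩, rfl⟩ := Submodule.mem_sup.1 hx
  rw [map_add]
  have h0 : A.C.d i j ((A.C.d (i + 1) i).hom w) = 0 := A.d_d _ _ _ w
  rw [h0, add_zero]
  by_cases hij : j + 1 = i
  · subst hij
    refine Submodule.mem_sup_right ⟨y, ?_, rfl⟩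
    rwa [show q + r - 1 = p - 1 by omega]
  · rw [A.C.shape i j hij]; exact zero_mem _

/-- The differential `E^r_{p,k} → E^r_{p-r,k-1}` induced by the differential of the complex. -/
def dE (A : FilteredComplex R) (r p q : ℤ) (i j : ℕ) (h : p - r = q) : A.E r p i →ₗ[R] A.E r q j :=
  Submodule.mapQ _ _
    ((A.C.d i j).hom.restrict (fun _ hx => A.d_mem_Z h hx r))
    (fun _ hx => A.d_mem_B h hx)

/-- The shape of the `r`-th page: the differential goes from `(p, k)` to `(p - r, k - 1)`. -/
abbrev pageShape (r : ℤ) : ComplexShape (ℕ × ℕ) :=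
  ComplexShape.spectralSequenceNat (-r, -1)

open Classical in
/-- The `r`-th page of the spectral sequence of a filtered complex. -/
noncomputable def page (A : FilteredComplex R) (r : ℤ) :
    HomologicalComplex (ModuleCat.{u} R) (pageShape r) where
  X pk := ModuleCat.of R (A.E r pk.1 pk.2)
  d i j := if h : (pageShape r).Rel i j then
    ModuleCat.ofHom (A.dE r i.1 j.1 i.2 j.2 (by have := h.1; omega)) else 0
  shape i j h := dif_neg h
  d_comp_d' i j k hij hjk := by
    rw [dif_pos hij, dif_pos hjk]
    ext x
    change A.cls _ _ _ ⟨A.C.d j.2 k.2 (A.C.d i.2 j.2 x.1), _⟩ = 0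
    refine (Submodule.Quotient.mk_eq_zero _).2 ?_
    change A.C.d j.2 k.2 (A.C.d i.2 j.2 x.1) ∈ A.B r k.1 k.2
    rw [A.d_d]; exact zero_mem _

lemma page_d_apply (A : FilteredComplex R) (r : ℤ) (i j : ℕ × ℕ) (h : (pageShape r).Rel i j)
    (x : A.Z r i.1 i.2) :
    (A.page r).d i j (A.cls r i.1 i.2 x) = A.cls r j.1 j.2
      ⟨A.C.d i.2 j.2 x.1, A.d_mem_Z (by have := h.1; omega) x.2 r⟩ := by
  simp only [page]
  rw [dif_pos h]
  rfl

lemma Z_mono (A : FilteredComplex R) {r p r' p' : ℤ} (h : p ≤ p') (h' : p - r ≤ p' - r') (k : ℕ) :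
    A.Z r p k ≤ A.Z r' p' k :=
  fun _ hx => ⟨A.mono h k hx.1, fun j => A.mono h' j (hx.2 j)⟩

/-- The homology of the `r`-th page is the page `r + 1`. -/
noncomputable def pageIso (A : FilteredComplex R) (r r' : ℤ) (pk : ℕ × ℕ) (hrr' : r + 1 = r')
    (hr : 0 ≤ r) : (A.page r).homology pk ≅ (A.page r').X pk :=
  ShortComplex.homologyIsoQuotient ((A.page r).sc pk) _
    ((A.cls r pk.1 pk.2).comp (Submodule.inclusion
      (A.Z_mono (r := r') (p := pk.1) (r' := r) (by omega) (by omega) pk.2)))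
    (by
      intro z
      change (A.page r).d pk ((pageShape r).next pk) (A.cls r pk.1 pk.2 _) = 0
      by_cases h : (pageShape r).Rel pk ((pageShape r).next pk)
      · rw [A.page_d_apply r _ _ h]
        refine (Submodule.Quotient.mk_eq_zero _).2 (Submodule.mem_sup_left ?_)
        exact A.d_mem_Z (by have := h.1; simp only at this; omega) z.2 _
      · rw [(A.page r).shape _ _ h]; rfl)
    (by
      intro x hx
      obtain ⟨x, rfl⟩ := Submodule.mkQ_surjective _ x
      change (A.page r).d pk ((pageShape r).next pk) (A.cls r pk.1 pk.2 x) = 0 at hx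
      -- it suffices to change `x` by an element of `B`
      suffices h : ∃ b ∈ A.B r pk.1 pk.2, x.1 - b ∈ A.Z r' pk.1 pk.2 by
        obtain ⟨b, hb, hxb⟩ := h
        refine ⟨⟨_, hxb⟩, 0, ?_⟩
        rw [map_zero, add_zero]
        refine ((Submodule.Quotient.eq _).2 ?_)
        change x.1 - (x.1 - b) ∈ A.B r pk.1 pk.2
        rwa [sub_sub_cancel]
      by_cases h : (pageShape r).Rel pk ((pageShape r).next pk)
      · rw [A.page_d_apply r _ _ h] at hx
        have hx := (Submodule.Quotient.mk_eq_zero _).1 hx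
        obtain ⟨h1, h2⟩ := h
        simp only at h1 h2
        generalize (pageShape r).next pk = qj at *
        obtain ⟨q, j⟩ := qj
        obtain ⟨p, k⟩ := pk
        simp only at h1 h2 hx x ⊢
        obtain rfl : k = j + 1 := by omega
        obtain ⟨a, ha, _, ⟨b, hb, rfl⟩, hab⟩ := Submodule.mem_sup.1 hx
        change a + A.C.d (j + 1) j b = A.C.d (j + 1) j x.1 at hab
        refine ⟨b, Submodule.mem_sup_left ?_, ?_⟩
        · rwa [show (p : ℤ) - 1 = q + r - 1 by omega]
        · refine ⟨sub_mem x.2.1 (A.mono (by omega) _ hb.1), fun l => ?_⟩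
          by_cases hl : l = j
          · subst hl
            rw [map_sub, ← hab, add_sub_cancel_right, show (p : ℤ) - r' = q - 1 by omega]
            exact ha.1
          · rw [A.C.shape _ _ (by simp [ComplexShape.down]; omega)]; exact zero_mem _
      · refine ⟨0, zero_mem _, ?_⟩
        rw [sub_zero]
        refine ⟨x.2.1, fun l => ?_⟩
        by_cases hl : l + 1 = pk.2
        · have hneg : (pk.1 : ℤ) - r < 0 := by
            by_contra hcon
            refine h ?_
            have hrel : (pageShape r).Rel pk (((pk.1 : ℤ) - r).toNat, l) :=
              ⟨by simp only; omega, by simp only; omega⟩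
            rwa [(pageShape r).next_eq' hrel]
          have := x.2.2 l
          rw [A.neg _ _ hneg] at this
          rw [(Submodule.mem_bot R).1 this]; exact zero_mem _
        · rw [A.C.shape _ _ hl]; exact zero_mem _)
    (by
      intro z
      have hrel : (pageShape r).Rel (((pk.1 : ℤ) + r).toNat, pk.2 + 1) pk :=
        ⟨by simp only; omega, by simp only; omega⟩
      have hp : ((((pk.1 : ℤ) + r).toNat : ℕ) : ℤ) = pk.1 + r := by omega
      have key : (∃ y, (A.page r).d (((pk.1 : ℤ) + r).toNat, pk.2 + 1) pk y =
          A.cls r pk.1 pk.2 (Submodule.inclusion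
            (A.Z_mono (r := r') (p := pk.1) (r' := r) (by omega) (by omega) pk.2) z)) ↔
          ∃ y ∈ A.Z r (pk.1 + r) (pk.2 + 1), A.C.d (pk.2 + 1) pk.2 y - z.1 ∈ A.B r pk.1 pk.2 := by
        constructor
        · rintro ⟨y, hy⟩
          obtain ⟨y, rfl⟩ := Submodule.mkQ_surjective _ y
          rw [A.page_d_apply r _ _ hrel] at hy
          have hy := (Submodule.Quotient.eq _).1 hy
          exact ⟨y.1, A.Z_mono hp.le (by omega) _ y.2, hy⟩
        · rintro ⟨y, hy, hyz⟩
          refine ⟨A.cls r _ _ ⟨y, by rw [hp]; exact hy⟩, ?_⟩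
          rw [A.page_d_apply r _ _ hrel]
          exact (Submodule.Quotient.eq _).2 hyz
      change z.1 ∈ A.B r' pk.1 pk.2 ↔ ∃ y, (A.page r).d ((pageShape r).prev pk) pk y = _
      rw [(pageShape r).prev_eq' hrel]
      refine Iff.trans ?_ key.symm
      constructor
      · intro hz
        obtain ⟨a, ha, _, ⟨y, hy, rfl⟩, hay⟩ := Submodule.mem_sup.1 hz
        change a + A.C.d (pk.2 + 1) pk.2 y = z.1 at hay
        refine ⟨y, A.Z_mono (by omega) (by omega) _ hy, Submodule.mem_sup_left ?_⟩
        rw [← hay, sub_add_cancel_right]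
        exact neg_mem (A.Z_mono (by omega) (by omega) _ ha)
      · rintro ⟨y, hy, hyz⟩
        obtain ⟨a, ha, _, ⟨w, hw, rfl⟩, haw⟩ := Submodule.mem_sup.1 hyz
        change a + A.C.d (pk.2 + 1) pk.2 w = A.C.d (pk.2 + 1) pk.2 y - z.1 at haw
        have hz : z.1 = -a + A.C.d (pk.2 + 1) pk.2 (y - w) := by
          rw [map_sub, eq_sub_of_add_eq' haw]
          abel
        have hd : A.C.d (pk.2 + 1) pk.2 (y - w) ∈ A.Z r' pk.1 pk.2 :=
          A.d_mem_Z (r := r) (p := pk.1 + r) (by omega)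
            (sub_mem hy (A.Z_mono (by omega) (by omega) _ hw)) r'
        have ha' : -a ∈ A.Z r' pk.1 pk.2 := by
          have := sub_mem z.2 hd
          rwa [hz, add_sub_cancel_right] at this
        rw [hz]
        refine add_mem (Submodule.mem_sup_left ⟨neg_mem ha.1, fun j => ?_⟩)
          (Submodule.mem_sup_right ⟨y - w, ?_, rfl⟩)
        · rw [show (pk.1 : ℤ) - 1 - (r' - 1) = pk.1 - r' by omega]
          exact ha'.2 j
        · exact sub_mem (A.Z_mono (by omega) (by omega) _ hy)
            (A.Z_mono (by omega) (by omega) _ hw))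

/-- The spectral sequence of a filtered complex. -/
noncomputable def spectralSequence (A : FilteredComplex R) :
    SpectralSequence (ModuleCat.{u} R) pageShape 0 where
  page r _ := A.page r
  iso r r' pk hrr' hr := A.pageIso r r' pk hrr' hr

end FilteredComplex

/-! ## Digraphs, distances and lengths of tuples -/

namespace Digraph

variable {V : Type u}

/-- `G.HasWalk n x y`: there is a directed path with `n` edges from `x` to `y` in `G`. -/
inductive HasWalk (G : Digraph V) : ℕ → V → V → Prop
  | nil (x : V) : HasWalk G 0 x x
  | cons {n : ℕ} {x y z : V} (h : G.Adj x y) (w : HasWalk G n y z) : HasWalk G (n + 1) x z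

/-- There is a directed path (possibly the constant one) from `x` to `y`. -/
def Reachable (G : Digraph V) (x y : V) : Prop := ∃ n, G.HasWalk n x y

/-- The directed distance: the minimal length of a directed path from `x` to `y`, and `⊤` if there
is none. -/
noncomputable def edist (G : Digraph V) (x y : V) : ℕ∞ := ⨅ (n : ℕ) (_ : G.HasWalk n x y), (n : ℕ∞)

/-- The length `∑ d(x_i, x_{i+1})` of a tuple `(x_0, …, x_k)`. -/
noncomputable def len (G : Digraph V) {k : ℕ} (x : Fin (k + 1) → V) : ℕ∞ :=
  ∑ i : Fin k, G.edist (x i.castSucc) (x i.succ)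

lemma HasWalk.append {G : Digraph V} {m n : ℕ} {x y z : V} (h : G.HasWalk m x y)
    (h' : G.HasWalk n y z) : G.HasWalk (m + n) x z := by
  induction h with
  | nil x => simpa using h'
  | cons e _ ih => rw [Nat.add_right_comm]; exact .cons e (ih h')

lemma edist_le {G : Digraph V} {n : ℕ} {x y : V} (h : G.HasWalk n x y) : G.edist x y ≤ n :=
  iInf₂_le n h

lemma edist_self (G : Digraph V) (x : V) : G.edist x x = 0 := by
  simpa using edist_le (HasWalk.nil (G := G) x)

lemma exists_hasWalk_of_edist_ne_top {G : Digraph V} {x y : V} (h : G.edist x y ≠ ⊤) :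
    ∃ n, G.HasWalk n x y ∧ G.edist x y = n := by
  classical
  have hex : ∃ n, G.HasWalk n x y := by
    by_contra hcon
    push Not at hcon
    exact h (by simp [edist, hcon])
  refine ⟨Nat.find hex, Nat.find_spec hex, le_antisymm (edist_le (Nat.find_spec hex)) ?_⟩
  exact le_iInf₂ fun n hn => by exact_mod_cast Nat.find_min' hex hn

lemma edist_triangle (G : Digraph V) (x y z : V) :
    G.edist x z ≤ G.edist x y + G.edist y z := by
  by_cases h : G.edist x y = ⊤
  · simp [h]
  by_cases h' : G.edist y z = ⊤
  · simp [h']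
  obtain ⟨m, hm, em⟩ := exists_hasWalk_of_edist_ne_top h
  obtain ⟨n, hn, en⟩ := exists_hasWalk_of_edist_ne_top h'
  rw [em, en]
  exact_mod_cast edist_le (hm.append hn)

lemma edist_ne_zero {G : Digraph V} {x y : V} (h : x ≠ y) : G.edist x y ≠ 0 := by
  intro h0
  obtain ⟨n, hn, en⟩ := exists_hasWalk_of_edist_ne_top (G := G) (x := x) (y := y) (by simp [h0])
  rw [h0] at en
  obtain rfl : n = 0 := by exact_mod_cast en.symm
  cases hn
  exact h rfl

/-- Passing to a subtuple, possibly with repetitions, does not increase the length. -/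
lemma len_comp_le (G : Digraph V) {m n : ℕ} (x : Fin (n + 1) → V) (σ : Fin (m + 1) → Fin (n + 1))
    (hσ : Monotone σ) : G.len (x ∘ σ) ≤ G.len x := by
  let y : ℕ → V := fun t => x ⟨min t n, by omega⟩
  let P : ℕ → ℕ∞ := fun t => ∑ i ∈ Finset.range t, G.edist (y i) (y (i + 1))
  have hy : ∀ i : Fin (n + 1), y i = x i := fun i => congrArg x (Fin.ext (by simp; omega))
  have hP : ∀ a b, a ≤ b → P a + G.edist (y a) (y b) ≤ P b := by
    intro a b hab
    induction b, hab using Nat.le_induction with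
    | base => simp [edist_self]
    | succ b hb ih =>
      calc P a + G.edist (y a) (y (b + 1))
          ≤ P a + (G.edist (y a) (y b) + G.edist (y b) (y (b + 1))) := by
            gcongr; exact G.edist_triangle _ _ _
        _ ≤ P b + G.edist (y b) (y (b + 1)) := by rw [← add_assoc]; gcongr
        _ = P (b + 1) := (Finset.sum_range_succ _ _).symm
  have hPm : ∀ a b, a ≤ b → P a ≤ P b := fun a b h => le_self_add.trans (hP a b h)
  have hlen : G.len x = P n := by
    simp only [len, P]
    rw [← Fin.sum_univ_eq_sum_range (fun i => G.edist (y i) (y (i + 1)))]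
    refine Finset.sum_congr rfl fun i _ => ?_
    rw [← hy i.castSucc, ← hy i.succ]; rfl
  let τ : ℕ → ℕ := fun t => (σ ⟨min t m, by omega⟩ : ℕ)
  have hτ : ∀ a b, a ≤ b → τ a ≤ τ b := fun a b h => hσ (by simp [Fin.le_def]; omega)
  have hind : ∀ t, ∑ i ∈ Finset.range t, G.edist (y (τ i)) (y (τ (i + 1))) ≤ P (τ t) := by
    intro t
    induction t with
    | zero => simp
    | succ t ih =>
      rw [Finset.sum_range_succ]
      exact (add_le_add_left ih _).trans (hP _ _ (hτ _ _ (Nat.le_succ t)))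
  rw [hlen]
  calc G.len (x ∘ σ) = ∑ i ∈ Finset.range m, G.edist (y (τ i)) (y (τ (i + 1))) := by
        rw [← Fin.sum_univ_eq_sum_range (fun i => G.edist (y (τ i)) (y (τ (i + 1))))]
        refine Finset.sum_congr rfl fun i _ => ?_
        have h1 : σ i.castSucc = σ ⟨min i m, by omega⟩ := congrArg σ (Fin.ext (by simp))
        have h2 : σ i.succ = σ ⟨min (i + 1) m, by omega⟩ := congrArg σ (Fin.ext (by simp))
        simp only [Function.comp, τ, hy, h1, h2]
    _ ≤ P (τ m) := hind m
    _ ≤ P n := hPm _ _ (by simp only [τ]; omega)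

lemma Reachable.refl (G : Digraph V) (x : V) : G.Reachable x x := ⟨0, .nil x⟩

lemma Reachable.trans {G : Digraph V} {x y z : V} (h : G.Reachable x y) (h' : G.Reachable y z) :
    G.Reachable x z :=
  let ⟨m, hm⟩ := h
  let ⟨n, hn⟩ := h'
  ⟨m + n, hm.append hn⟩

/-! ## The reachability category and its nerves -/

/-- The reachability category of `G`: its objects are the vertices, and there is exactly one
morphism from `x` to `y` if there is a directed path from `x` to `y`, and none otherwise. -/
def Reach (_ : Digraph V) : Type u := V

instance (G : Digraph V) : Preorder G.Reach where
  le x y := G.Reachable x y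
  le_refl := Reachable.refl G
  le_trans _ _ _ := Reachable.trans

end Digraph

/-- The injective nerve of a category: the simplicial subset of the nerve whose simplices are the
functors `[m] → C` which are injective on objects and all their degeneracies. (Faces of functors
which are injective on objects are again such, so allowing all `σ : [n] → [m]` adds nothing to
the surjective ones.) -/
def injectiveNerve (C : Type u) [Category.{u} C] : (nerve C).Subcomplex where
  obj Δ := {s | ∃ (m : SimplexCategory) (t : (nerve C).obj (.op m)) (σ : Δ.unop ⟶ m),
    Function.Injective t.obj ∧ s = (nerve C).map σ.op t}
  map {Δ Δ'} f := by
    rintro _ ⟨m, t, σ, ht, rfl⟩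
    exact ⟨m, t, f.unop ≫ σ, ht, by rw [op_comp, Functor.map_comp_apply]; rfl⟩

namespace Digraph

variable {V : Type u}

/-- The filtration step `F_p` of the nerve of the reachability category: the simplices
`(x_0, …, x_k)` of length at most `p`. It is empty for `p < 0`. -/
def lengthFiltration (G : Digraph V) (p : ℤ) : (nerve G.Reach).Subcomplex where
  obj Δ := {s | ∃ n : ℕ, G.len (V := V) s.obj ≤ n ∧ (n : ℤ) ≤ p}
  map {Δ Δ'} f := by
    rintro s ⟨n, hn, hp⟩
    exact ⟨n, (G.len_comp_le (V := V) s.obj f.unop.toOrderHom f.unop.toOrderHom.monotone).trans hn,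
      hp⟩

/-- The filtration step `F_p` of the injective nerve of the reachability category. -/
def injLengthFiltration (G : Digraph V) (p : ℤ) :
    (injectiveNerve G.Reach : SSet.{u}).Subcomplex :=
  (G.lengthFiltration p).preimage (injectiveNerve G.Reach).ι

end Digraph

/-! ## The filtered normalized chain complexes and their spectral sequences -/

namespace FilteredComplex

variable (R : Type u) [CommRing R]

/-- The normalized chain complex `N(X)` of a filtered simplicial set `X`, filtered by the images of
`N(F_p X) → N(X)`. -/
noncomputable def ofSSet (X : SSet.{u}) (F : ℤ → X.Subcomplex) (hF : Monotone F)
    (hF₀ : ∀ p < 0, F p = ⊥) : FilteredComplex R where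
  C := X.normalizedChainComplex (ModuleCat.of R R)
  F p k := LinearMap.range ((SSet.normalizedChainComplexMap (F p).ι (ModuleCat.of R R)).f k).hom
  mono {p q} hpq k := by
    rintro _ ⟨x, rfl⟩
    refine ⟨(SSet.normalizedChainComplexMap (SSet.Subcomplex.homOfLE (hF hpq))
      (ModuleCat.of R R)).f k x, ?_⟩
    have h := (SSet.normalizedChainComplexFunctorObj (ModuleCat.of R R)).map_comp
      (SSet.Subcomplex.homOfLE (hF hpq)) (F q).ι
    have h' := congrArg (fun φ => φ.f k x) h
    exact h'.symm
  d_mem p i j := by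
    rintro _ ⟨x, rfl⟩
    refine ⟨((F p : SSet.{u}).normalizedChainComplex (ModuleCat.of R R)).d i j x, ?_⟩
    have h := (SSet.normalizedChainComplexMap (F p).ι (ModuleCat.of R R)).comm i j
    exact (congrArg (fun φ => φ x) h).symm
  neg p k hp := by
    have h : (SSet.normalizedChainComplexMap (F p).ι (ModuleCat.of R R)).f k = 0 := by
      apply SSet.normalizedChainComplex_hom_ext
      rintro ⟨x, hx⟩
      rw [hF₀ p hp] at hx
      exact hx.elim
    rw [h]
    exact LinearMap.range_zero

variable {R}

/-- A chain map which preserves the filtrations. -/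
structure Hom (A A' : FilteredComplex R) where
  f : A.C ⟶ A'.C
  map_mem : ∀ (p : ℤ) (k : ℕ) (x : A.C.X k), x ∈ A.F p k → f.f k x ∈ A'.F p k

/-- A filtered chain map sends `Z^r_p` to `Z^r_p`. -/
noncomputable def Hom.mapZ {A A' : FilteredComplex R} (φ : Hom A A') (r p : ℤ) (k : ℕ) :
    A.Z r p k →ₗ[R] A'.Z r p k :=
  (φ.f.f k).hom.restrict fun x hx => ⟨φ.map_mem p k x hx.1, fun j => by
    have h := congrArg (fun ψ => ψ x) (φ.f.comm k j)
    change A'.C.d k j (φ.f.f k x) = φ.f.f j (A.C.d k j x) at h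
    change A'.C.d k j (φ.f.f k x) ∈ _
    rw [h]
    exact φ.map_mem _ _ _ (hx.2 j)⟩

end FilteredComplex

namespace Digraph

variable {V : Type u} (R : Type u) [CommRing R]

lemma lengthFiltration_mono (G : Digraph V) : Monotone G.lengthFiltration := by
  rintro p q hpq Δ s ⟨n, hn, hp⟩
  exact ⟨n, hn, hp.trans hpq⟩

lemma lengthFiltration_neg (G : Digraph V) (p : ℤ) (hp : p < 0) : G.lengthFiltration p = ⊥ := by
  ext Δ s
  refine ⟨?_, fun h => h.elim⟩
  rintro ⟨n, -, hn⟩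
  omega

/-- The normalized chains of the nerve of the reachability category, with the length filtration. -/
noncomputable def nerveComplex (G : Digraph V) : FilteredComplex R :=
  .ofSSet R (nerve G.Reach) G.lengthFiltration G.lengthFiltration_mono G.lengthFiltration_neg

/-- The normalized chains of the injective nerve of the reachability category, with the length
filtration. -/
noncomputable def injNerveComplex (G : Digraph V) : FilteredComplex R :=
  .ofSSet R (injectiveNerve G.Reach) G.injLengthFiltration
    (fun _ _ h _ _ hs => G.lengthFiltration_mono h _ hs)
    (fun p hp => by unfold injLengthFiltration; rw [G.lengthFiltration_neg p hp]; rfl)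

/-- The magnitude-path spectral sequence. -/
noncomputable def magnitudePathSS (G : Digraph V) :
    SpectralSequence (ModuleCat.{u} R) FilteredComplex.pageShape 0 :=
  (G.nerveComplex R).spectralSequence

/-- The regular magnitude-path spectral sequence. -/
noncomputable def regularMagnitudePathSS (G : Digraph V) :
    SpectralSequence (ModuleCat.{u} R) FilteredComplex.pageShape 0 :=
  (G.injNerveComplex R).spectralSequence

/-- The filtered chain map induced by the inclusions `F_p N^ι(Reach_G) ⊆ F_p N(Reach_G)`. -/
noncomputable def inclusionHom (G : Digraph V) :
    FilteredComplex.Hom (G.injNerveComplex R) (G.nerveComplex R) where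
  f := SSet.normalizedChainComplexMap (injectiveNerve G.Reach).ι (ModuleCat.of R R)
  map_mem p k := by
    rintro _ ⟨x, rfl⟩
    let g : (G.injLengthFiltration p : SSet.{u}) ⟶ (G.lengthFiltration p : SSet.{u}) :=
      SSet.Subcomplex.lift ((G.injLengthFiltration p).ι ≫ (injectiveNerve G.Reach).ι)
        (by rintro Δ _ ⟨y, rfl⟩; exact y.2)
    refine ⟨(SSet.normalizedChainComplexMap g (ModuleCat.of R R)).f k x, ?_⟩
    have h := (SSet.normalizedChainComplexFunctorObj (ModuleCat.of R R)).map_comp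
      g (G.lengthFiltration p).ι
    have h' := (SSet.normalizedChainComplexFunctorObj (ModuleCat.of R R)).map_comp
      (G.injLengthFiltration p).ι (injectiveNerve G.Reach).ι
    have h₁ := congrArg (fun φ => φ.f k x) h
    have h₂ := congrArg (fun φ => φ.f k x) h'
    exact h₁.symm.trans h₂

/-! ## Chain complexes of tuples of vertices -/

/-- The free module on all `(k+1)`-tuples of vertices. -/
abbrev Tuples (V R : Type u) [CommRing R] (k : ℕ) : Type u := (Fin (k + 1) → V) →₀ R

/-- The boundary `∑ (-1)^i ∂_i`, where `∂_i` forgets the `i`-th entry. -/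
noncomputable def boundary (V R : Type u) [CommRing R] (k : ℕ) :
    Tuples V R (k + 1) →ₗ[R] Tuples V R k :=
  Finsupp.linearCombination R fun x =>
    ∑ i : Fin (k + 2), (-1 : R) ^ (i : ℕ) • Finsupp.single (x ∘ i.succAbove) 1

lemma boundary_single (k : ℕ) (x : Fin (k + 2) → V) :
    boundary V R k (Finsupp.single x 1) =
      ∑ i : Fin (k + 2), (-1 : R) ^ (i : ℕ) • Finsupp.single (x ∘ i.succAbove) 1 := by
  simp [boundary]

lemma boundary_boundary (k : ℕ) (c : Tuples V R (k + 2)) :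
    boundary V R k (boundary V R (k + 1) c) = 0 := by
  suffices h : (boundary V R k).comp (boundary V R (k + 1)) = 0 from LinearMap.congr_fun h c
  refine Finsupp.lhom_ext' fun x => LinearMap.ext_ring ?_
  change boundary V R k (boundary V R (k + 1) (Finsupp.single x 1)) = 0
  rw [boundary_single, map_sum]
  simp only [map_smul, boundary_single, Finset.smul_sum, smul_smul]
  rw [Finset.sum_comm, ← Finset.sum_product']
  let P := Fin (k + 2) × Fin (k + 3)
  let S : Finset P := {ij : P | (ij.2 : ℕ) ≤ (ij.1 : ℕ)}
  rw [Finset.univ_product_univ, ← Finset.sum_add_sum_compl S, ← eq_neg_iff_add_eq_zero,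
    ← Finset.sum_neg_distrib]
  let φ : ∀ ij : P, ij ∈ S → P := fun ij hij =>
    (Fin.castLT ij.2 (lt_of_le_of_lt (Finset.mem_filter.mp hij).right (Fin.is_lt ij.1)), ij.1.succ)
  apply Finset.sum_bij φ
  · intro ij hij
    simp_rw [S, φ, Finset.compl_filter, Finset.mem_filter_univ, Fin.val_succ,
      Fin.val_castLT] at hij ⊢
    lia
  · rintro ⟨i, j⟩ hij ⟨i', j'⟩ hij' h
    rw [Prod.mk_inj]
    exact ⟨by simpa [φ] using! congr_arg Prod.snd h,
      by simpa [φ, Fin.castSucc_castLT] using! congr_arg Fin.castSucc (congr_arg Prod.fst h)⟩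
  · rintro ⟨i', j'⟩ hij'
    simp_rw [S, Finset.compl_filter, Finset.mem_filter_univ, not_le] at hij'
    refine ⟨(j'.pred <| ?_, Fin.castSucc i'), ?_, ?_⟩
    · rintro rfl
      simp only [Fin.val_zero, not_lt_zero] at hij'
    · simpa [S] using! Nat.le_sub_one_of_lt hij'
    · simp only [φ, Fin.castLT_castSucc, Fin.succ_pred]
  · rintro ⟨i, j⟩ hij
    have hij : (j : ℕ) ≤ i := by simpa [S] using! hij
    have hx : (x ∘ j.succAbove) ∘ i.succAbove =
        (x ∘ i.succ.succAbove) ∘ (Fin.castLT j (by omega) : Fin (k + 2)).succAbove := by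
      funext t
      simp only [Function.comp]
      congr 1
      ext
      have hv : ∀ {n : ℕ} (p : Fin (n + 1)) (q : Fin n),
          (p.succAbove q : ℕ) = if (q : ℕ) < p then (q : ℕ) else q + 1 := fun p q => by
        simp only [Fin.succAbove, Fin.lt_def, Fin.val_castSucc]
        split_ifs <;> rfl
      simp only [hv, Fin.val_succ, Fin.val_castLT]
      split_ifs <;> omega
    simp only [φ, Fin.val_succ, Fin.val_castLT, hx, ← neg_smul]
    congr 1
    ring

/-- The chain complex with `M k ⊆ Tuples V R k` in degree `k` and differential the restriction of
`D`. -/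
noncomputable def tupleComplex {V R : Type u} [CommRing R] (M : ∀ k, Submodule R (Tuples V R k))
    (D : ∀ k, Tuples V R (k + 1) →ₗ[R] Tuples V R k) (hD : ∀ k, ∀ c ∈ M (k + 1), D k c ∈ M k)
    (hDD : ∀ k, ∀ c ∈ M (k + 2), D k (D (k + 1) c) = 0) : ChainComplex (ModuleCat.{u} R) ℕ :=
  ChainComplex.of (fun k => ModuleCat.of R (M k)) (fun k => ModuleCat.ofHom ((D k).restrict (hD k)))
    (fun k => by
      refine ModuleCat.hom_ext (LinearMap.ext fun c => Subtype.ext ?_)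
      exact hDD k c.1 c.2)

lemma boundary_mem_supported {P : ∀ k, Set (Fin (k + 1) → V)}
    (hP : ∀ k, ∀ x ∈ P (k + 1), ∀ i : Fin (k + 2), x ∘ i.succAbove ∈ P k) (k : ℕ)
    (c : Tuples V R (k + 1)) (hc : c ∈ Finsupp.supported R R (P (k + 1))) :
    boundary V R k c ∈ Finsupp.supported R R (P k) := by
  rw [Finsupp.supported_eq_span_single] at hc
  refine Submodule.span_induction (p := fun c _ => boundary V R k c ∈ Finsupp.supported R R (P k))
    ?_ ?_ ?_ ?_ hc
  · rintro _ ⟨x, hx, rfl⟩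
    rw [boundary_single]
    exact Submodule.sum_mem _ fun i _ => Submodule.smul_mem _ _
      (Finsupp.single_mem_supported R _ (hP k x hx i))
  · rw [map_zero]; exact zero_mem _
  · intro a b _ _ ha hb; rw [map_add]; exact add_mem ha hb
  · intro t a _ ha; rw [map_smul]; exact Submodule.smul_mem _ _ ha

/-- Injective words on `G`: tuples of pairwise distinct vertices such that there is a directed path
from `x_i` to `x_j` whenever `i < j`. -/
def IsInjWord (G : Digraph V) {k : ℕ} (x : Fin (k + 1) → V) : Prop :=
  Function.Injective x ∧ ∀ i j, i < j → G.Reachable (x i) (x j)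

/-- The chain complex of the complex of injective words `Inj(G)`, whose `k`-simplices are the
injective words with `k + 1` letters and whose faces are given by forgetting letters. -/
noncomputable def injWordsComplex (G : Digraph V) : ChainComplex (ModuleCat.{u} R) ℕ :=
  tupleComplex (fun _ => Finsupp.supported R R {x : Fin _ → V | G.IsInjWord x}) (boundary V R)
    (boundary_mem_supported R fun _ _ hx i =>
      ⟨hx.1.comp Fin.succAbove_right_injective,
        fun _ _ h => hx.2 _ _ (Fin.strictMono_succAbove i h)⟩)
    (fun k c _ => boundary_boundary R k c)

/-- Strongly regular allowed elementary paths: tuples of pairwise distinct vertices with an edge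
from each vertex to the next. -/
def IsStronglyRegularPath (G : Digraph V) {k : ℕ} (x : Fin (k + 1) → V) : Prop :=
  Function.Injective x ∧ ∀ i : Fin k, G.Adj (x i.castSucc) (x i.succ)

/-- The free module on the strongly regular allowed elementary paths. -/
noncomputable def stronglyRegularPaths (G : Digraph V) (k : ℕ) : Submodule R (Tuples V R k) :=
  Finsupp.supported R R {x | G.IsStronglyRegularPath x}

/-- The module of `∂`-invariant strongly regular allowed paths: those chains of strongly regular
allowed paths whose boundary is again such a chain. -/
noncomputable def regularOmega (G : Digraph V) : ∀ k : ℕ, Submodule R (Tuples V R k)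
  | 0 => G.stronglyRegularPaths R 0
  | k + 1 => G.stronglyRegularPaths R (k + 1) ⊓ (G.stronglyRegularPaths R k).comap (boundary V R k)

lemma boundary_mem_regularOmega (G : Digraph V) (k : ℕ) (c : Tuples V R (k + 1))
    (hc : c ∈ G.regularOmega R (k + 1)) : boundary V R k c ∈ G.regularOmega R k := by
  cases k with
  | zero => exact hc.2
  | succ k =>
    refine ⟨hc.2, ?_⟩
    change boundary V R k (boundary V R (k + 1) c) ∈ G.stronglyRegularPaths R k
    rw [boundary_boundary]
    exact zero_mem _

/-- The chain complex whose homology is the regular path homology. -/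
noncomputable def regularPathComplex (G : Digraph V) : ChainComplex (ModuleCat.{u} R) ℕ :=
  tupleComplex (G.regularOmega R) (boundary V R) (G.boundary_mem_regularOmega R)
    (fun k c _ => boundary_boundary R k c)

/-- The regular path homology of `G`. -/
noncomputable abbrev regularPathHomology (G : Digraph V) (k : ℕ) : ModuleCat.{u} R :=
  (G.regularPathComplex R).homology k

/-- The eulerian magnitude chains: the free module on the tuples of pairwise distinct vertices of
length `l`. -/
noncomputable def eulerianChains (G : Digraph V) (l k : ℕ) : Submodule R (Tuples V R k) :=
  Finsupp.supported R R {x | Function.Injective x ∧ G.len x = l}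

open Classical in
/-- The magnitude differential in length `l`: the sum of `(-1)^i ∂_i` over the inner indices
`i = 1, …, k` of a tuple `(x_0, …, x_{k+1})`, where `∂_i` forgets the `i`-th entry if the result has
length `l` and is zero otherwise. -/
noncomputable def magnitudeBoundary (G : Digraph V) (l k : ℕ) :
    Tuples V R (k + 1) →ₗ[R] Tuples V R k :=
  Finsupp.linearCombination R fun x => ∑ i : Fin k, (-1 : R) ^ ((i : ℕ) + 1) •
    if G.len (x ∘ i.succ.castSucc.succAbove) = l
      then Finsupp.single (x ∘ i.succ.castSucc.succAbove) 1 else 0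

open Classical in
/-- The projection onto the span of the tuples of length `l`. -/
noncomputable def lenProj (G : Digraph V) (l k : ℕ) : Tuples V R k →ₗ[R] Tuples V R k :=
  Finsupp.linearCombination R fun x => if G.len x = l then Finsupp.single x 1 else 0

lemma lenProj_single (G : Digraph V) (l k : ℕ) (x : Fin (k + 1) → V) [Decidable (G.len x = l)] :
    G.lenProj R l k (Finsupp.single x 1) = if G.len x = l then Finsupp.single x 1 else 0 := by
  simp only [lenProj, Finsupp.linearCombination_single, one_smul]
  split_ifs <;> rfl

lemma len_succAbove_zero_ne (G : Digraph V) {l k : ℕ} (x : Fin (k + 2) → V)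
    (hx : Function.Injective x) (hl : G.len x = l) : G.len (x ∘ (0 : Fin (k + 2)).succAbove) ≠ l := by
  intro h
  have h1 : G.len x = G.edist (x 0) (x 1) + G.len (x ∘ (0 : Fin (k + 2)).succAbove) := by
    simp only [len]; rw [Fin.sum_univ_succ]; rfl
  rw [hl, h] at h1
  have h0 : G.edist (x 0) (x 1) ≠ 0 := edist_ne_zero (fun e => by simpa using hx e)
  generalize G.edist (x 0) (x 1) = e at *
  induction e using ENat.recTopCoe with
  | top => simp at h1
  | coe e => norm_cast at h1 h0; omega

lemma len_succAbove_last_ne (G : Digraph V) {l k : ℕ} (x : Fin (k + 2) → V)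
    (hx : Function.Injective x) (hl : G.len x = l) :
    G.len (x ∘ (Fin.last (k + 1)).succAbove) ≠ l := by
  intro h
  have h1 : G.len x = G.len (x ∘ (Fin.last (k + 1)).succAbove) +
      G.edist (x (Fin.last k).castSucc) (x (Fin.last k).succ) := by
    simp only [len]; rw [Fin.sum_univ_castSucc]; simp
  rw [hl, h] at h1
  have h0 : G.edist (x (Fin.last k).castSucc) (x (Fin.last k).succ) ≠ 0 :=
    edist_ne_zero (fun e => by simpa [Fin.ext_iff] using hx e)
  generalize G.edist (x (Fin.last k).castSucc) (x (Fin.last k).succ) = e at *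
  induction e using ENat.recTopCoe with
  | top => simp at h1
  | coe e => norm_cast at h1 h0; omega

/-- On tuples of distinct vertices of length `l`, the magnitude differential is the length `l` part
of the full boundary. -/
lemma magnitudeBoundary_eq (G : Digraph V) (l k : ℕ) (c : Tuples V R (k + 1))
    (hc : c ∈ G.eulerianChains R l (k + 1)) :
    G.magnitudeBoundary R l k c = G.lenProj R l k (boundary V R k c) := by
  classical
  rw [eulerianChains, Finsupp.supported_eq_span_single] at hc
  refine Submodule.span_induction (p := fun c _ => G.magnitudeBoundary R l k c =
    G.lenProj R l k (boundary V R k c)) ?_ ?_ ?_ ?_ hc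
  · rintro _ ⟨x, hx, rfl⟩
    rw [boundary_single, map_sum]
    simp only [map_smul, lenProj_single]
    rw [Fin.sum_univ_succ, if_neg (G.len_succAbove_zero_ne x hx.1 hx.2), smul_zero, zero_add,
      Fin.sum_univ_castSucc, Fin.succ_last, if_neg (G.len_succAbove_last_ne x hx.1 hx.2), smul_zero,
      add_zero]
    simp only [magnitudeBoundary, Finsupp.linearCombination_single, one_smul]
    refine Finset.sum_congr rfl fun i _ => ?_
    rw [Fin.succ_castSucc]
    congr 1
  · simp only [map_zero]
  · intro a b _ _ ha hb; simp only [map_add, ha, hb]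
  · intro t a _ ha; simp only [map_smul, ha]

lemma lenProj_boundary_lenProj (G : Digraph V) (l k : ℕ) (c : Tuples V R (k + 1))
    (hc : c ∈ Finsupp.supported R R {x : Fin (k + 2) → V | G.len x ≤ l}) :
    G.lenProj R l k (boundary V R k (G.lenProj R l (k + 1) c)) =
      G.lenProj R l k (boundary V R k c) := by
  classical
  rw [Finsupp.supported_eq_span_single] at hc
  refine Submodule.span_induction (p := fun c _ =>
    G.lenProj R l k (boundary V R k (G.lenProj R l (k + 1) c)) =
      G.lenProj R l k (boundary V R k c)) ?_ ?_ ?_ ?_ hc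
  · rintro _ ⟨x, hx, rfl⟩
    rw [lenProj_single]
    split_ifs with h
    · rfl
    · rw [map_zero, map_zero, boundary_single, map_sum]
      refine (Finset.sum_eq_zero fun i _ => ?_).symm
      rw [map_smul, lenProj_single, if_neg, smul_zero]
      intro h'
      have := G.len_comp_le x i.succAbove (Fin.strictMono_succAbove i).monotone
      rw [h'] at this
      exact h (le_antisymm hx this)
  · simp only [map_zero]
  · intro a b _ _ ha hb; simp only [map_add, ha, hb]
  · intro t a _ ha; simp only [map_smul, ha]

lemma magnitudeBoundary_mem (G : Digraph V) (l k : ℕ) (c : Tuples V R (k + 1))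
    (hc : c ∈ G.eulerianChains R l (k + 1)) :
    G.magnitudeBoundary R l k c ∈ G.eulerianChains R l k := by
  rw [eulerianChains, Finsupp.supported_eq_span_single] at hc
  refine Submodule.span_induction
    (p := fun c _ => G.magnitudeBoundary R l k c ∈ G.eulerianChains R l k) ?_ ?_ ?_ ?_ hc
  · rintro _ ⟨x, hx, rfl⟩
    simp only [magnitudeBoundary, Finsupp.linearCombination_single, one_smul]
    refine Submodule.sum_mem _ fun i _ => Submodule.smul_mem _ _ ?_
    split_ifs with h
    · exact Finsupp.single_mem_supported R _ ⟨hx.1.comp Fin.succAbove_right_injective, h⟩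
    · exact zero_mem _
  · rw [map_zero]; exact zero_mem _
  · intro a b _ _ ha hb; rw [map_add]; exact add_mem ha hb
  · intro t a _ ha; rw [map_smul]; exact Submodule.smul_mem _ _ ha

lemma magnitudeBoundary_magnitudeBoundary (G : Digraph V) (l k : ℕ) (c : Tuples V R (k + 2))
    (hc : c ∈ G.eulerianChains R l (k + 2)) :
    G.magnitudeBoundary R l k (G.magnitudeBoundary R l (k + 1) c) = 0 := by
  rw [G.magnitudeBoundary_eq R l k _ (G.magnitudeBoundary_mem R l (k + 1) c hc),
    G.magnitudeBoundary_eq R l (k + 1) c hc, G.lenProj_boundary_lenProj R l k, boundary_boundary,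
    map_zero]
  refine boundary_mem_supported R (P := fun k => {x : Fin (k + 1) → V | G.len x ≤ l})
    (fun k x hx i => (G.len_comp_le x i.succAbove (Fin.strictMono_succAbove i).monotone).trans hx)
    (k + 1) c ?_
  exact Finsupp.supported_mono (fun x hx => hx.2.le) hc

/-- The eulerian magnitude chain complex of `G` in length `l`. -/
noncomputable def eulerianMagnitudeComplex (G : Digraph V) (l : ℕ) :
    ChainComplex (ModuleCat.{u} R) ℕ :=
  tupleComplex (G.eulerianChains R l) (G.magnitudeBoundary R l) (G.magnitudeBoundary_mem R l)
    (G.magnitudeBoundary_magnitudeBoundary R l)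

/-- The eulerian magnitude homology `EMH_{k,l}(G)`. -/
noncomputable abbrev eulerianMagnitudeHomology (G : Digraph V) (k l : ℕ) : ModuleCat.{u} R :=
  (G.eulerianMagnitudeComplex R l).homology k

/-! ## Comparison of words with simplices, and convergence -/

/-- The simplex of the injective nerve of the reachability category given by an injective word. -/
def wordSimplex (G : Digraph V) {k : ℕ} (x : Fin (k + 1) → V) (hx : G.IsInjWord x) :
    (injectiveNerve G.Reach : SSet.{u}).obj (.op (.mk k)) :=
  let t : (nerve G.Reach).obj (.op (.mk k)) :=
    Monotone.functor (Y := G.Reach) (f := x) fun i j h => by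
      rcases h.eq_or_lt with rfl | h
      · exact Reachable.refl G _
      · exact hx.2 i j h
  ⟨t, .mk k, t, 𝟙 _, hx.1, (Functor.map_id_apply (nerve G.Reach) _ t).symm⟩

open Classical in
/-- The linear map from tuples of vertices to the normalized chains of the injective nerve which
sends an injective word to the corresponding simplex (and other tuples to zero). -/
noncomputable def wordChain (G : Digraph V) (k : ℕ) :
    Tuples V R k →ₗ[R] (G.injNerveComplex R).C.X k :=
  Finsupp.linearCombination R fun x => if hx : G.IsInjWord x then
    (SSet.ιNormalizedChainComplex (R := ModuleCat.of R R) _ (G.wordSimplex x hx)).hom (1 : R) else 0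

/-- The inclusion of the eulerian magnitude chains into the chains of all tuples. -/
noncomputable def eulerianIncl (G : Digraph V) (l k : ℕ) :
    (G.eulerianMagnitudeComplex R l).X k →ₗ[R] Tuples V R k :=
  (G.eulerianChains R l k).subtype

/-- The inclusion of the `∂`-invariant strongly regular allowed paths into the chains of all
tuples. -/
noncomputable def regularPathIncl (G : Digraph V) (k : ℕ) :
    (G.regularPathComplex R).X k →ₗ[R] Tuples V R k :=
  (G.regularOmega R k).subtype

/-- The inclusion of the chains of injective words on `G` into the chains of all tuples. -/
noncomputable def injWordsIncl (G : Digraph V) (k : ℕ) :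
    (G.injWordsComplex R).X k →ₗ[R] Tuples V R k :=
  (Finsupp.supported R R {x : Fin (k + 1) → V | G.IsInjWord x}).subtype

/-- The submodule of the homology of `Inj(G)` of all classes which are represented by a cycle
supported on injective words of length at most `p`. -/
noncomputable def injWordsHomologyFiltration (G : Digraph V) (k : ℕ) (p : ℤ) :
    Submodule R ((G.injWordsComplex R).homology k) :=
  ((Finsupp.supported R R {x : Fin (k + 1) → V | ∃ n : ℕ, G.len x ≤ n ∧ (n : ℤ) ≤ p}).comap
    ((G.injWordsIncl R k).comp ((G.injWordsComplex R).iCycles k).hom)).map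
      ((G.injWordsComplex R).homologyπ k).hom

end Digraph

/-- Convergence of a spectral sequence to graded modules `H k` with filtrations `Φ k`: each
filtration is increasing, zero in negative degrees and equal to `H k` from some degree on; and at
each position `(p, k)` the differentials vanish from some page on and the stable value
`E^∞_{p,k}` is isomorphic to `Φ_p H_k / Φ_{p-1} H_k`. The last condition says that the isomorphisms
for different pages agree under the identification of a page with the next one. -/
def ConvergesTo {R : Type u} [CommRing R]
    (E : SpectralSequence (ModuleCat.{u} R) FilteredComplex.pageShape 0)
    (H : ℕ → ModuleCat.{u} R) (Φ : ∀ k, ℤ → Submodule R (H k)) : Prop :=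
  (∀ k, Monotone (Φ k)) ∧ (∀ k, ∀ p < 0, Φ k p = ⊥) ∧ (∀ k, ∃ p, Φ k p = ⊤) ∧
  ∀ p k : ℕ, ∃ (r₀ : ℤ) (h₀ : 0 ≤ r₀),
    (∀ (r : ℤ) (hr : r₀ ≤ r) (qj : ℕ × ℕ),
      (E.page r (h₀.trans hr)).d (p, k) qj = 0 ∧ (E.page r (h₀.trans hr)).d qj (p, k) = 0) ∧
    ∃ e : ∀ (r : ℤ) (hr : r₀ ≤ r), (E.page r (h₀.trans hr)).X (p, k) ≅
        ModuleCat.of R (Φ k p ⧸ (Φ k ((p : ℤ) - 1)).comap (Φ k p).subtype),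
      ∀ (r : ℤ) (hr : r₀ ≤ r),
        (E.page r (h₀.trans hr)).iCycles (p, k) ≫ (e r hr).hom =
          (E.page r (h₀.trans hr)).homologyπ (p, k) ≫
            (E.iso r (r + 1) (p, k) rfl (h₀.trans hr)).hom ≫ (e (r + 1) (by omega)).hom

/-! A simplex of the injective nerve is nondegenerate exactly when its vertices are distinct, and a
functor into the preorder `Reach` is determined by its vertices. The normalized chains of the
injective nerve are therefore free on the injective words. The maps `chainTuple` and `wordChain`
identify them with the chains of tuples supported on injective words; under this identification the
differential is the alternating sum of faces (`chainTuple_d`) and `F_p` is the condition that all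
tuples in the support have length at most `p` (`mem_F_iff`). From there on the pages can be computed
with tuples.

First page: faces never increase length, so `Z^0_l = F_l`, and `Z^1_l` consists of the chains of
length at most `l` whose boundary has no part of length `l`. Taking the part of length `l`
(`leadingPart`) maps `Z^1_l` onto the eulerian magnitude cycles, and what it sends to boundaries is
exactly `B^1_l` (`mem_B_one_iff`).

Diagonal of the second page: each of the `k` steps of a tuple of distinct vertices has length at
least one. Hence `F_p C_k = 0` for `p < k` (`F_eq_bot`), and `F_k C_k` is spanned by the tuples all
of whose steps are edges (`mem_F_diag_iff`). In degree `k` this makes `Z^1_k` the module `Ω_k` and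
`Z^2_k` its cycles, kills the first summand of `B^2_k`, and turns the second into `∂Ω_{k+1}`
(`mem_B_two_iff`).

Convergence: the filtration vanishes in negative degrees and, `V` being finite, is everything in
each chain degree from some step on. Once `r > p`, elements of `Z^r_p` are cycles; once `F_{p+r-1}
C_{k+1}` is everything, such a cycle lies in `B^r_p` if and only if it is homologous to a cycle in
`F_{p-1}` (`gradedOfZ_eq_zero_iff`). So the quotient is the associated graded module of the
homology.

The comparison with the full nerve is formal: a filtered chain map preserves `Z` and `B`, and
commutes with the identification of the homology of a page with the next page. -/

/-! ### Homology of modules in terms of cycles and boundaries -/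

section ShortComplex

variable {R : Type u} [CommRing R]

lemma ShortComplex.homologyIsoQuotient_inv_mk (S : ShortComplex (ModuleCat.{u} R)) {Z : Type u}
    [AddCommGroup Z] [Module R Z] (N : Submodule R Z) (φ : Z →ₗ[R] S.X₂)
    (h₁ : ∀ z, S.g (φ z) = 0) (h₂ : ∀ x, S.g x = 0 → ∃ z y, x = φ z + S.f y)
    (h₃ : ∀ z, z ∈ N ↔ ∃ y, S.f y = φ z) (z : Z) :
    (ShortComplex.homologyIsoQuotient S N φ h₁ h₂ h₃).inv (N.mkQ z) =
      S.homologyπ (S.liftCycles (ModuleCat.ofHom φ) (by ext z; exact h₁ z) z) :=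
  rfl

/-- Makes the isomorphism computable on any cycle: cycles embed in `S.X₂`, so `c` must be the lift
of `φ z`, on which the inverse is known by construction. -/
lemma ShortComplex.homologyIsoQuotient_hom_π (S : ShortComplex (ModuleCat.{u} R)) {Z : Type u}
    [AddCommGroup Z] [Module R Z] (N : Submodule R Z) (φ : Z →ₗ[R] S.X₂)
    (h₁ : ∀ z, S.g (φ z) = 0) (h₂ : ∀ x, S.g x = 0 → ∃ z y, x = φ z + S.f y)
    (h₃ : ∀ z, z ∈ N ↔ ∃ y, S.f y = φ z) (c : S.cycles) (z : Z) (h : S.iCycles c = φ z) :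
    (ShortComplex.homologyIsoQuotient S N φ h₁ h₂ h₃).hom (S.homologyπ c) = N.mkQ z := by
  have hc : c = S.liftCycles (ModuleCat.ofHom φ) (by ext z; exact h₁ z) z := by
    apply (ModuleCat.mono_iff_injective S.iCycles).1 inferInstance
    rw [h, ← ConcreteCategory.comp_apply, S.liftCycles_i]; rfl
  rw [hc, ← ShortComplex.homologyIsoQuotient_inv_mk S N φ h₁ h₂ h₃, Iso.inv_hom_id_apply]

end ShortComplex

section ChainComplex

variable {R : Type u} [CommRing R] (K : ChainComplex (ModuleCat.{u} R) ℕ)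

lemma ChainComplex.iCycles_injective (k : ℕ) : Function.Injective (K.iCycles k) :=
  (ModuleCat.mono_iff_injective _).1 inferInstance

lemma ChainComplex.homologyπ_surjective (k : ℕ) : Function.Surjective (K.homologyπ k) :=
  (ModuleCat.epi_iff_surjective _).1 inferInstance

lemma ChainComplex.d_iCycles (k j : ℕ) (c : K.cycles k) : K.d k j (K.iCycles k c) = 0 := by
  rw [← ConcreteCategory.comp_apply, K.iCycles_d]; rfl

/-- Homology is the cokernel of `toCycles`, so the sequence is exact at the cycles; injectivity of
`iCycles` then moves the equation into `K.X k`. -/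
lemma ChainComplex.homologyπ_eq_zero_iff (k : ℕ) (c : K.cycles k) :
    K.homologyπ k c = 0 ↔ ∃ y : K.X (k + 1), K.d (k + 1) k y = K.iCycles k c := by
  have hi : ∀ y, K.iCycles k (K.toCycles (k + 1) k y) = K.d (k + 1) k y := fun y => by
    rw [← ConcreteCategory.comp_apply, K.toCycles_i]
  have hex := ShortComplex.exact_of_g_is_cokernel
    (ShortComplex.mk (K.toCycles (k + 1) k) (K.homologyπ k) (K.toCycles_comp_homologyπ _ _))
    (K.homologyIsCokernel (k + 1) k (by simp))
  constructor
  · intro h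
    obtain ⟨y, hy⟩ := (ShortComplex.moduleCat_exact_iff _).1 hex c h
    refine ⟨y, ?_⟩
    rw [← hi]
    exact congrArg _ hy
  · rintro ⟨y, hy⟩
    rw [← K.iCycles_injective k ((hi y).trans hy), ← ConcreteCategory.comp_apply,
      K.toCycles_comp_homologyπ]
    rfl

end ChainComplex

/-! ### Functoriality of the spectral sequence in filtered chain maps -/

namespace FilteredComplex

variable {R : Type u} [CommRing R]

section pageIso

variable (A : FilteredComplex R) {r r' : ℤ} {pk : ℕ × ℕ} (hrr' : r + 1 = r') (hr : 0 ≤ r)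

lemma Z_succ_le {r r' : ℤ} (hrr' : r + 1 = r') (p : ℤ) (k : ℕ) : A.Z r' p k ≤ A.Z r p k :=
  A.Z_mono le_rfl (by omega) k

lemma pageIso_hom_π (c : (A.page r).cycles pk) (z : A.Z r' pk.1 pk.2)
    (h : (A.page r).iCycles pk c =
      A.cls r pk.1 pk.2 (Submodule.inclusion (A.Z_succ_le hrr' pk.1 pk.2) z)) :
    (A.pageIso r r' pk hrr' hr).hom ((A.page r).homologyπ pk c) = A.cls r' pk.1 pk.2 z :=
  ShortComplex.homologyIsoQuotient_hom_π _ _ _ _ _ _ c z h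

/-- Together with `pageIso_hom_π` this reduces statements about `pageIso` to elements of `Z^{r+1}`.
The representative comes from lifting the image of `x` on the next page, since the inverse of
`pageIso` is defined by lifting such elements to cycles. -/
lemma exists_rep {r r' : ℤ} {pk : ℕ × ℕ} (hrr' : r + 1 = r') (hr : 0 ≤ r)
    (x : (A.page r).homology pk) :
    ∃ (c : (A.page r).cycles pk) (z : A.Z r' pk.1 pk.2), (A.page r).homologyπ pk c = x ∧
      (A.page r).iCycles pk c =
        A.cls r pk.1 pk.2 (Submodule.inclusion (A.Z_succ_le hrr' pk.1 pk.2) z) := by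
  obtain ⟨z, hz⟩ := Submodule.mkQ_surjective _ ((A.pageIso r r' pk hrr' hr).hom x)
  have h := congrArg (A.pageIso r r' pk hrr' hr).inv hz
  rw [Iso.hom_inv_id_apply] at h
  exact ⟨_, z, h, congrArg (fun f : ModuleCat.of R (A.Z r' pk.1 pk.2) ⟶ (A.page r).X pk => f z)
    (((A.page r).sc pk).liftCycles_i _ _)⟩

end pageIso

namespace Hom

variable {A A' : FilteredComplex R} (φ : Hom A A')

lemma comm_apply (i j : ℕ) (x : A.C.X i) : φ.f.f j (A.C.d i j x) = A'.C.d i j (φ.f.f i x) :=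
  (congrArg (fun ψ => ψ x) (φ.f.comm i j)).symm

lemma map_mem_B (r p : ℤ) (k : ℕ) {x : A.C.X k} (hx : x ∈ A.B r p k) :
    φ.f.f k x ∈ A'.B r p k := by
  obtain ⟨y, hy, _, ⟨w, hw, rfl⟩, rfl⟩ := Submodule.mem_sup.1 hx
  rw [map_add]
  refine add_mem (Submodule.mem_sup_left (φ.mapZ _ _ _ ⟨y, hy⟩).2)
    (Submodule.mem_sup_right ⟨_, (φ.mapZ _ _ _ ⟨w, hw⟩).2, ?_⟩)
  exact (φ.comm_apply _ _ w).symm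

/-- The map on the terms of the spectral sequence induced by a filtered chain map. -/
noncomputable def mapE (r p : ℤ) (k : ℕ) : A.E r p k →ₗ[R] A'.E r p k :=
  Submodule.mapQ _ _ (φ.mapZ r p k) fun _ hx => φ.map_mem_B r p k hx

lemma mapE_cls (r p : ℤ) (k : ℕ) (z : A.Z r p k) :
    φ.mapE r p k (A.cls r p k z) = A'.cls r p k (φ.mapZ r p k z) := rfl

/-- The map on pages induced by a filtered chain map. -/
noncomputable def mapPage (r : ℤ) : A.page r ⟶ A'.page r where
  f pk := ModuleCat.ofHom (φ.mapE r pk.1 pk.2)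
  comm' i j hij := by
    refine ModuleCat.hom_ext (LinearMap.ext fun x => ?_)
    obtain ⟨z, rfl⟩ := Submodule.mkQ_surjective _ x
    change (A'.page r).d i j (A'.cls r i.1 i.2 (φ.mapZ r i.1 i.2 z)) =
      φ.mapE r j.1 j.2 ((A.page r).d i j (A.cls r i.1 i.2 z))
    rw [A.page_d_apply r i j hij, A'.page_d_apply r i j hij, mapE_cls]
    exact congrArg _ (Subtype.ext (φ.comm_apply _ _ _).symm)

lemma mapPage_cls (r : ℤ) (pk : ℕ × ℕ) (z : A.Z r pk.1 pk.2) :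
    (φ.mapPage r).f pk (A.cls r pk.1 pk.2 z) = A'.cls r pk.1 pk.2 (φ.mapZ r pk.1 pk.2 z) := rfl

/-- The morphism of spectral sequences induced by a filtered chain map. -/
noncomputable def mapSpectralSequence : A.spectralSequence ⟶ A'.spectralSequence :=
  SpectralSequence.Hom.mk (fun r _ => φ.mapPage r) fun r r' pk hrr' hr => by
    refine ModuleCat.hom_ext (LinearMap.ext fun x => ?_)
    change (A'.pageIso r r' pk hrr' hr).hom
        (HomologicalComplex.homologyMap (φ.mapPage r) pk x) =
      (φ.mapPage r').f pk ((A.pageIso r r' pk hrr' hr).hom x)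
    -- With `z` in `Z^{r+1}` representing the class, both composites send it to the class of the
    -- image of `z` on page `r'`.
    obtain ⟨c, z, rfl, hc⟩ := A.exists_rep hrr' hr x
    have h₁ : HomologicalComplex.homologyMap (φ.mapPage r) pk ((A.page r).homologyπ pk c) =
        (A'.page r).homologyπ pk (HomologicalComplex.cyclesMap (φ.mapPage r) pk c) :=
      congrArg (fun f => f c) (HomologicalComplex.homologyπ_naturality (φ.mapPage r) pk)
    have h₂ : (A'.page r).iCycles pk (HomologicalComplex.cyclesMap (φ.mapPage r) pk c) =
        (φ.mapPage r).f pk ((A.page r).iCycles pk c) :=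
      congrArg (fun f => f c) (HomologicalComplex.cyclesMap_i (φ.mapPage r) pk)
    rw [A.pageIso_hom_π hrr' hr c z hc, mapPage_cls, h₁]
    refine A'.pageIso_hom_π hrr' hr _ _ ?_
    rw [h₂, hc, mapPage_cls]
    rfl

end Hom

end FilteredComplex

/-! ### Convergence for filtrations exhausting each chain degree at a finite step -/

namespace FilteredComplex

variable {R : Type u} [CommRing R]

section Convergence

variable (A : FilteredComplex R)

/-- The differential lands in `F_{p-r}`, a negative step of the filtration. -/
lemma d_eq_zero_of_mem_Z {r p : ℤ} {k : ℕ} (h : p < r) {x : A.C.X k} (hx : x ∈ A.Z r p k) (j : ℕ) :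
    A.C.d k j x = 0 := by
  have := hx.2 j
  rwa [A.neg _ _ (by omega), Submodule.mem_bot] at this

lemma mem_Z_of_d_eq_zero {p : ℤ} {k : ℕ} {x : A.C.X k} (hx : x ∈ A.F p k)
    (h : ∀ j, A.C.d k j x = 0) (r : ℤ) : x ∈ A.Z r p k :=
  ⟨hx, fun j => by rw [h]; exact zero_mem _⟩

lemma page_d_from_eq_zero {r : ℤ} {p k : ℕ} (h : (p : ℤ) < r) (qj : ℕ × ℕ) :
    (A.page r).d (p, k) qj = 0 := by
  refine (A.page r).shape _ _ fun hrel => ?_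
  have := hrel.1
  simp only at this
  omega

/-- A source element `z` has filtration degree `p + r`, but lowering this by one costs nothing as
`F_{p+r-1}` is already everything. Thus `z` lies in `Z^{r-1}_{p+r-1}`, and `dz` is one of the
elements divided out in `B^r_p`. -/
lemma page_d_to_eq_zero {r : ℤ} {p k : ℕ} (h : ∀ q, (p : ℤ) + r - 1 ≤ q → A.F q (k + 1) = ⊤)
    (qj : ℕ × ℕ) : (A.page r).d qj (p, k) = 0 := by
  by_cases hrel : (pageShape r).Rel qj (p, k)
  · refine ModuleCat.hom_ext (LinearMap.ext fun x => ?_)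
    obtain ⟨z, rfl⟩ := Submodule.mkQ_surjective _ x
    refine (A.page_d_apply r _ _ hrel z).trans ((Submodule.Quotient.mk_eq_zero _).2 ?_)
    obtain ⟨q, j⟩ := qj
    obtain ⟨h1, h2⟩ := hrel
    simp only at h1 h2
    obtain rfl : j = k + 1 := by omega
    refine Submodule.mem_sup_right ⟨z.1, ⟨?_, fun l => ?_⟩, rfl⟩
    · rw [h _ le_rfl]; trivial
    · have := z.2.2 l
      simpa only [show (q : ℤ) - r = p + r - 1 - (r - 1) by omega] using this
  · exact (A.page r).shape _ _ hrel

variable {A} {K : ChainComplex (ModuleCat.{u} R) ℕ} (θ : K ≅ A.C)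

/-- The cycle of `K ≅ A.C` given by an element of `Z^r_p`, for `p < r`. -/
noncomputable def cycleOfZ {r p : ℤ} (h : p < r) (k : ℕ) : A.Z r p k →ₗ[R] K.cycles k :=
  (K.liftCycles (A := ModuleCat.of R (A.Z r p k))
    (ModuleCat.ofHom ((θ.inv.f k).hom.comp (A.Z r p k).subtype)) _ rfl (by
      refine ModuleCat.hom_ext (LinearMap.ext fun z => ?_)
      have := congrArg (fun ψ => ψ z.1) (θ.inv.comm k ((ComplexShape.down ℕ).next k))
      refine this.trans ?_
      change θ.inv.f _ (A.C.d _ _ z.1) = 0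
      rw [A.d_eq_zero_of_mem_Z h z.2, map_zero])).hom

lemma iCycles_cycleOfZ {r p : ℤ} (h : p < r) (k : ℕ) (z : A.Z r p k) :
    θ.hom.f k (K.iCycles k (cycleOfZ θ h k z)) = z.1 := by
  have h1 : K.iCycles k (cycleOfZ θ h k z) = θ.inv.f k z.1 :=
    congrArg (fun f : ModuleCat.of R (A.Z r p k) ⟶ K.X k => f z) (K.liftCycles_i _ _ _ _)
  rw [h1]
  exact congrArg (fun ψ => ψ.f k z.1) θ.inv_hom_id

lemma hom_d_apply (i j : ℕ) (x : K.X i) :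
    θ.hom.f j (K.d i j x) = A.C.d i j (θ.hom.f i x) :=
  (congrArg (fun ψ => ψ x) (θ.hom.comm i j)).symm

lemma hom_f_injective (k : ℕ) : Function.Injective (θ.hom.f k) :=
  (ModuleCat.mono_iff_injective _).1 inferInstance

lemma hom_f_surjective (k : ℕ) : Function.Surjective (θ.hom.f k) :=
  (ModuleCat.epi_iff_surjective _).1 inferInstance

variable {Φ : ∀ k, ℤ → Submodule R (K.homology k)}
  (hΦ : ∀ k p h, h ∈ Φ k p ↔
    ∃ c : K.cycles k, θ.hom.f k (K.iCycles k c) ∈ A.F p k ∧ K.homologyπ k c = h)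

/-- The map from `Z^r_p` to the associated graded of the filtration of the homology. -/
noncomputable def gradedOfZ {r p : ℤ} (h : p < r) (k : ℕ) :
    A.Z r p k →ₗ[R] Φ k p ⧸ (Φ k (p - 1)).comap (Φ k p).subtype :=
  (Submodule.mkQ _).comp ((((K.homologyπ k).hom.comp (cycleOfZ θ h k))).codRestrict (Φ k p)
    fun z => (hΦ _ _ _).2 ⟨cycleOfZ θ h k z, by rw [iCycles_cycleOfZ]; exact z.2.1, rfl⟩)

lemma gradedOfZ_surjective {r p : ℤ} (h : p < r) (k : ℕ) :
    Function.Surjective (gradedOfZ θ hΦ h k) := by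
  intro y
  obtain ⟨⟨y, hy⟩, rfl⟩ := Submodule.mkQ_surjective _ y
  obtain ⟨c, hc, rfl⟩ := (hΦ _ _ _).1 hy
  have hz : θ.hom.f k (K.iCycles k c) ∈ A.Z r p k := A.mem_Z_of_d_eq_zero hc (fun j => by
    rw [← hom_d_apply, ChainComplex.d_iCycles, map_zero]) r
  refine ⟨⟨_, hz⟩, congrArg (Submodule.mkQ _) (Subtype.ext (congrArg (K.homologyπ k) ?_))⟩
  exact K.iCycles_injective k (hom_f_injective θ k (iCycles_cycleOfZ θ h k ⟨_, hz⟩))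

/-- The heart of convergence: `z` is a cycle, and its class comes from `F_{p-1}` if and only if `z =
c + dy` with `c` a cycle in `F_{p-1}`. No bound on the filtration degree of `y` is needed because of
`htop`. -/
lemma gradedOfZ_eq_zero_iff {r p : ℤ} (h : p < r) (k : ℕ)
    (htop : A.F (p + r - 1) (k + 1) = ⊤) (z : A.Z r p k) :
    gradedOfZ θ hΦ h k z = 0 ↔ z.1 ∈ A.B r p k := by
  have h1 : gradedOfZ θ hΦ h k z = 0 ↔ K.homologyπ k (cycleOfZ θ h k z) ∈ Φ k (p - 1) :=
    Submodule.Quotient.mk_eq_zero _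
  rw [h1, hΦ]
  constructor
  · rintro ⟨c, hc, hcz⟩
    have h2 : K.homologyπ k (cycleOfZ θ h k z - c) = 0 := by rw [map_sub, hcz, sub_self]
    obtain ⟨y, hy⟩ := (ChainComplex.homologyπ_eq_zero_iff K k _).1 h2
    have h3 := congrArg (θ.hom.f k) hy
    rw [hom_d_apply, map_sub, map_sub, iCycles_cycleOfZ] at h3
    rw [← sub_add_cancel z.1 (θ.hom.f k (K.iCycles k c)), ← h3, add_comm]
    -- The remaining condition for `y` to lie in `Z^{r-1}_{p+r-1}` is `dy ∈ F_p`, which holds since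
    -- `dy = z - c`.
    refine add_mem (Submodule.mem_sup_left (A.mem_Z_of_d_eq_zero hc (fun j => by
      rw [← hom_d_apply, ChainComplex.d_iCycles, map_zero]) _))
      (Submodule.mem_sup_right ⟨θ.hom.f (k + 1) y, ⟨by rw [htop]; trivial, fun j => ?_⟩, rfl⟩)
    by_cases hj : j = k
    · subst hj
      rw [h3, show p + r - 1 - (r - 1) = p by omega]
      exact sub_mem z.2.1 (A.mono (by omega) _ hc)
    · rw [A.C.shape _ _ (by simp [ComplexShape.down]; omega)]; exact zero_mem _
  · intro hz
    obtain ⟨a, ha, _, ⟨y, hy, rfl⟩, hay⟩ := Submodule.mem_sup.1 hz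
    change a + A.C.d (k + 1) k y = z.1 at hay
    -- Both `z` and `dy` are cycles, hence so is `a`, and it satisfies the condition for every page.
    have ha' : a ∈ A.Z r (p - 1) k := A.Z_mono (p := p - 1) (r := r) le_rfl le_rfl _
      ⟨ha.1, fun j => by
        have : a = z.1 - A.C.d (k + 1) k y := by rw [← hay, add_sub_cancel_right]
        rw [this, map_sub, A.d_d, A.d_eq_zero_of_mem_Z h z.2, sub_zero]
        exact zero_mem _⟩
    refine ⟨cycleOfZ θ (r := r) (p := p - 1) (by omega) k ⟨a, ha'⟩, ?_, ?_⟩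
    · rw [iCycles_cycleOfZ]; exact ha.1
    · obtain ⟨w, rfl⟩ := hom_f_surjective θ (k + 1) y
      rw [← sub_eq_zero, ← map_sub, ChainComplex.homologyπ_eq_zero_iff]
      -- The sign appears because the difference of the two cycles is `a - z = -dy`.
      refine ⟨-w, hom_f_injective θ k ?_⟩
      rw [map_neg, map_neg, hom_d_apply, map_sub, map_sub, iCycles_cycleOfZ, iCycles_cycleOfZ,
        ← hay]
      simp

/-- The identification of the stable value of the spectral sequence. -/
noncomputable def gradedIso {r p : ℤ} (h : p < r) (k : ℕ)
    (htop : A.F (p + r - 1) (k + 1) = ⊤) :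
    ModuleCat.of R (A.E r p k) ≅
      ModuleCat.of R (Φ k p ⧸ (Φ k (p - 1)).comap (Φ k p).subtype) :=
  have hker : (A.B r p k).comap (A.Z r p k).subtype = LinearMap.ker (gradedOfZ θ hΦ h k) := by
    ext z
    exact (gradedOfZ_eq_zero_iff θ hΦ h k htop z).symm
  ((Submodule.quotEquivOfEq _ _ hker).trans
    ((gradedOfZ θ hΦ h k).quotKerEquivOfSurjective (gradedOfZ_surjective θ hΦ h k))).toModuleIso

lemma gradedIso_hom_cls {r p : ℤ} (h : p < r) (k : ℕ)
    (htop : A.F (p + r - 1) (k + 1) = ⊤) (z : A.Z r p k) :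
    (gradedIso θ hΦ h k htop).hom (A.cls r p k z) = gradedOfZ θ hΦ h k z := rfl

/-- The spectral sequence of a filtered complex whose filtration is exhaustive in each degree
converges to the homology of the complex. -/
theorem convergesTo {A : FilteredComplex R} {K : ChainComplex (ModuleCat.{u} R) ℕ} (θ : K ≅ A.C)
    {Φ : ∀ k, ℤ → Submodule R (K.homology k)}
    (hΦ : ∀ k p h, h ∈ Φ k p ↔
      ∃ c : K.cycles k, θ.hom.f k (K.iCycles k c) ∈ A.F p k ∧ K.homologyπ k c = h)
    (hA : ∀ k, ∃ p, A.F p k = ⊤) :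
    ConvergesTo A.spectralSequence (fun k => K.homology k) Φ := by
  have hF : ∀ {p q k}, p ≤ q → A.F p k = ⊤ → A.F q k = ⊤ := fun hpq h =>
    top_le_iff.1 (h ▸ A.mono hpq _)
  refine ⟨fun k p q hpq x hx => ?_, fun k p hp => ?_, fun k => ?_, fun p k => ?_⟩
  · obtain ⟨c, hc, rfl⟩ := (hΦ _ _ _).1 hx
    exact (hΦ _ _ _).2 ⟨c, A.mono hpq _ hc, rfl⟩
  · refine (Submodule.eq_bot_iff _).2 fun x hx => ?_
    obtain ⟨c, hc, rfl⟩ := (hΦ _ _ _).1 hx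
    rw [A.neg _ _ hp, Submodule.mem_bot] at hc
    rw [K.iCycles_injective k (hom_f_injective θ k (hc.trans (by simp)) : _ = K.iCycles k 0),
      map_zero]
  · obtain ⟨p, hp⟩ := hA k
    refine ⟨p, (Submodule.eq_top_iff'.2 fun x => ?_)⟩
    obtain ⟨c, rfl⟩ := K.homologyπ_surjective k x
    exact (hΦ _ _ _).2 ⟨c, by rw [hp]; trivial, rfl⟩
  · obtain ⟨N, hN⟩ := hA (k + 1)
    -- The page bound has two parts: `r ≥ p + 1` makes `Z^r_p` consist of cycles, and `r ≥ N + 1`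
    -- gives `p + r - 1 ≥ N`, so that `F_{p+r-1}` is everything in degree `k + 1`.
    have hlt : ∀ {r : ℤ}, max (p + 1 : ℤ) (N + 1) ≤ r → (p : ℤ) < r := fun hr => by
      have := (le_max_left _ _).trans hr; omega
    have htop : ∀ {r : ℤ}, max (p + 1 : ℤ) (N + 1) ≤ r → ∀ q, (p : ℤ) + r - 1 ≤ q →
        A.F q (k + 1) = ⊤ := fun hr q hq => by
      have := (le_max_right _ _).trans hr
      exact hF (by omega) hN
    refine ⟨max (p + 1 : ℤ) (N + 1), le_max_of_le_left (by omega), fun r hr qj =>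
      ⟨A.page_d_from_eq_zero (hlt hr) qj, A.page_d_to_eq_zero (htop hr) qj⟩,
      fun r hr => gradedIso θ hΦ (hlt hr) k (htop hr _ le_rfl), fun r hr => ?_⟩
    have hr0 : 0 ≤ r := by have := hlt hr; omega
    refine ModuleCat.hom_ext (LinearMap.ext fun c => ?_)
    change (gradedIso θ hΦ (hlt hr) k (htop hr _ le_rfl)).hom ((A.page r).iCycles (p, k) c) =
      (gradedIso θ hΦ (r := r + 1) (hlt (by omega)) k (htop (by omega) _ le_rfl)).hom
        ((A.pageIso r (r + 1) (p, k) rfl hr0).hom ((A.page r).homologyπ (p, k) c))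
    obtain ⟨z, hz⟩ := Submodule.mkQ_surjective _ ((A.page r).iCycles (p, k) c)
    -- As `z` is a cycle of the whole complex, the same element represents the class on page `r +
    -- 1`; both isomorphisms then return the homology class of this cycle.
    let z' : A.Z (r + 1) p k :=
      ⟨z.1, A.mem_Z_of_d_eq_zero z.2.1 (A.d_eq_zero_of_mem_Z (hlt hr) z.2) _⟩
    rw [A.pageIso_hom_π rfl hr0 c z' hz.symm, ← hz, gradedIso_hom_cls, gradedIso_hom_cls]
    refine congrArg (Submodule.mkQ _) (Subtype.ext (congrArg (K.homologyπ k) ?_))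
    refine K.iCycles_injective k (hom_f_injective θ k ?_)
    rw [iCycles_cycleOfZ, iCycles_cycleOfZ]

end Convergence

end FilteredComplex

/-! ### Generators of normalized chains and nondegenerate simplices -/

namespace SSet

variable {R : Type u} [CommRing R]

/-- The quotient map by the span kills every generator, and a map out of the normalized chains is
determined by its values on generators. -/
lemma span_ιNormalizedChainComplex (X : SSet.{u}) (n : ℕ) :
    Submodule.span R (Set.range fun x : X.obj (.op (.mk n)) =>
      (X.ιNormalizedChainComplex (R := ModuleCat.of R R) x).hom (1 : R)) = ⊤ := by
  set S := Submodule.span R (Set.range fun x : X.obj (.op (.mk n)) =>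
      (X.ιNormalizedChainComplex (R := ModuleCat.of R R) x).hom (1 : R))
  have h : ModuleCat.ofHom S.mkQ = 0 := by
    apply SSet.normalizedChainComplex_hom_ext
    intro x _
    refine ModuleCat.hom_ext (LinearMap.ext_ring ?_)
    exact (Submodule.Quotient.mk_eq_zero _).2 (Submodule.subset_span ⟨x, rfl⟩)
  rw [← Submodule.ker_mkQ S]
  exact LinearMap.ker_eq_top.2 (congrArg ModuleCat.Hom.hom h)

end SSet

/-- A simplex of the injective nerve is nondegenerate if and only if it is injective on objects. -/
lemma mem_nonDegenerate_injectiveNerve_iff {C : Type u} [Category.{u} C] {n : ℕ}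
    (s : (injectiveNerve C : SSet.{u}).obj (.op (.mk n))) :
    s ∈ (injectiveNerve C : SSet.{u}).nonDegenerate n ↔ Function.Injective s.1.obj := by
  rw [SSet.mem_nonDegenerate_iff_notMem_degenerate, ← not_iff_not, not_not]
  constructor
  · intro hs hinj
    cases n with
    | zero => simp at hs
    | succ n =>
      simp only [SSet.degenerate_eq_iUnion_range_σ, Set.mem_iUnion, Set.mem_range] at hs
      obtain ⟨i, y, rfl⟩ := hs
      -- A degenerate simplex repeats the vertex in positions `i` and `i + 1`.
      have h : y.1.obj (i.predAbove i.castSucc) = y.1.obj (i.predAbove i.succ) := by simp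
      exact Fin.castSucc_lt_succ.ne (hinj h)
  · intro hs
    obtain ⟨s, m, t, σ, ht, rfl⟩ := s
    cases n with
    | zero =>
      exact (hs fun a b _ => Subsingleton.elim (α := Fin 1) a b).elim
    | succ n =>
      -- As `t` is injective, the repetition is due to `σ`, which therefore factors through a
      -- codegeneracy; what remains is again a simplex of the injective nerve. In the full nerve
      -- this fails, since a nondegenerate simplex may return to a vertex later.
      have hσ : ¬ Function.Injective σ.toOrderHom := fun hσ => hs (ht.comp hσ)
      obtain ⟨i, σ', rfl⟩ := SimplexCategory.eq_σ_comp_of_not_injective σ hσ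
      rw [SSet.degenerate_eq_iUnion_range_σ]
      refine Set.mem_iUnion.2 ⟨i, ⟨(nerve C).map σ'.op t, m, t, σ', ht, rfl⟩, Subtype.ext ?_⟩
      exact (Functor.map_comp_apply (nerve C) σ'.op (SimplexCategory.σ i).op t).symm

/-! ### Normalized chains of the injective nerve as chains of injective words -/

namespace Digraph

variable {V : Type u} (R : Type u) [CommRing R]

lemma isInjWord_of_injective (G : Digraph V) {k : ℕ}
    (s : (nerve G.Reach).obj (.op (.mk k))) (hs : Function.Injective s.obj) :
    G.IsInjWord (V := V) s.obj :=
  ⟨hs, fun _ _ h => leOfHom (s.map (homOfLE h.le))⟩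

/-- The tuple of vertices of a simplex of the injective nerve. -/
def simplexTuple (G : Digraph V) {k : ℕ}
    (s : (injectiveNerve G.Reach : SSet.{u}).obj (.op (.mk k))) : Fin (k + 1) → V := s.1.obj

lemma simplexTuple_wordSimplex (G : Digraph V) {k : ℕ} (x : Fin (k + 1) → V)
    (hx : G.IsInjWord x) : G.simplexTuple (G.wordSimplex x hx) = x := rfl

/-- Morphisms in a preorder are unique, so functors agreeing on objects are equal. -/
lemma injNerve_ext (G : Digraph V) {k : ℕ}
    {s t : (injectiveNerve G.Reach : SSet.{u}).obj (.op (.mk k))}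
    (h : ∀ i, s.1.obj i = t.1.obj i) : s = t :=
  Subtype.ext (CategoryTheory.Functor.ext h fun _ _ _ => Subsingleton.elim _ _)

lemma wordSimplex_eq (G : Digraph V) {k : ℕ}
    (s : (injectiveNerve G.Reach : SSet.{u}).obj (.op (.mk k)))
    (hs : G.IsInjWord (G.simplexTuple s)) : G.wordSimplex (G.simplexTuple s) hs = s :=
  G.injNerve_ext fun _ => rfl

/-- The generator of the normalized chains of the injective nerve given by a simplex. -/
noncomputable def simplexChain (G : Digraph V) {k : ℕ}
    (s : (injectiveNerve G.Reach : SSet.{u}).obj (.op (.mk k))) : (G.injNerveComplex R).C.X k :=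
  (SSet.ιNormalizedChainComplex (R := ModuleCat.of R R) _ s).hom (1 : R)

lemma wordChain_single (G : Digraph V) {k : ℕ} (x : Fin (k + 1) → V) (hx : G.IsInjWord x) :
    G.wordChain R k (Finsupp.single x 1) = G.simplexChain R (G.wordSimplex x hx) := by
  classical
  rw [wordChain, Finsupp.linearCombination_single, one_smul]
  exact dif_pos hx

/-- The tuple of vertices underlying a chain of simplices of the injective nerve. -/
noncomputable def chainTuple (G : Digraph V) (k : ℕ) :
    (G.injNerveComplex R).C.X k →ₗ[R] Tuples V R k :=
  ((SSet.isColimitCofanNormalizedChainComplex (injectiveNerve G.Reach : SSet.{u})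
    (ModuleCat.of R R) k).desc (Limits.Cofan.mk (ModuleCat.of R (Tuples V R k)) fun s =>
      ModuleCat.ofHom (Finsupp.lsingle (R := R) (M := R) (G.simplexTuple s.1)))).hom

lemma chainTuple_simplexChain (G : Digraph V) {k : ℕ}
    (s : (injectiveNerve G.Reach : SSet.{u}).obj (.op (.mk k)))
    (hs : G.IsInjWord (G.simplexTuple s)) :
    G.chainTuple R k (G.simplexChain R s) = Finsupp.single (G.simplexTuple s) 1 := by
  have h := (SSet.isColimitCofanNormalizedChainComplex (injectiveNerve G.Reach : SSet.{u})
    (ModuleCat.of R R) k).fac (Limits.Cofan.mk (ModuleCat.of R (Tuples V R k)) fun s =>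
      ModuleCat.ofHom (Finsupp.lsingle (R := R) (M := R) (G.simplexTuple s.1)))
      ⟨⟨s, (mem_nonDegenerate_injectiveNerve_iff s).2 hs.1⟩⟩
  exact congrArg (fun f : ModuleCat.of R R ⟶ ModuleCat.of R (Tuples V R k) => f.hom (1 : R)) h

lemma simplexChain_eq_zero (G : Digraph V) {k : ℕ}
    (s : (injectiveNerve G.Reach : SSet.{u}).obj (.op (.mk k)))
    (hs : ¬ G.IsInjWord (G.simplexTuple s)) : G.simplexChain R s = 0 := by
  have h : s ∈ (injectiveNerve G.Reach : SSet.{u}).degenerate k := by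
    by_contra h
    refine hs (G.isInjWord_of_injective _ ?_)
    rwa [← mem_nonDegenerate_injectiveNerve_iff, SSet.mem_nonDegenerate_iff_notMem_degenerate]
  exact congrArg (fun f => f.hom (1 : R))
    (SSet.ιNormalizedChainComplex_eq_zero (R := ModuleCat.of R R) _ s h)

/-- Induction principle for checking linear identities on injective words only: simplices generate,
and those that are not injective words are degenerate, hence zero as chains. -/
lemma chain_induction (G : Digraph V) {k : ℕ} {S : Submodule R ((G.injNerveComplex R).C.X k)}
    (h : ∀ x : Fin (k + 1) → V, ∀ hx : G.IsInjWord x, G.simplexChain R (G.wordSimplex x hx) ∈ S) :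
    S = ⊤ := by
  rw [← top_le_iff]
  refine (SSet.span_ιNormalizedChainComplex (R := R)
    (injectiveNerve G.Reach : SSet.{u}) k).ge.trans (Submodule.span_le.2 ?_)
  rintro _ ⟨s, rfl⟩
  change G.simplexChain R s ∈ S
  by_cases hs : G.IsInjWord (G.simplexTuple s)
  · rw [← G.wordSimplex_eq s hs]; exact h _ hs
  · rw [G.simplexChain_eq_zero R s hs]; exact zero_mem _

lemma chainTuple_mem (G : Digraph V) (k : ℕ) (c : (G.injNerveComplex R).C.X k) :
    G.chainTuple R k c ∈ Finsupp.supported R R {x : Fin (k + 1) → V | G.IsInjWord x} := by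
  have := G.chain_induction R (k := k) (S := (Finsupp.supported R R
    {x : Fin (k + 1) → V | G.IsInjWord x}).comap (G.chainTuple R k)) fun x hx => by
      rw [Submodule.mem_comap, G.chainTuple_simplexChain R (G.wordSimplex x hx) hx]
      exact Finsupp.single_mem_supported R _ hx
  exact this.ge (Submodule.mem_top (x := c))

lemma wordChain_chainTuple (G : Digraph V) (k : ℕ) (c : (G.injNerveComplex R).C.X k) :
    G.wordChain R k (G.chainTuple R k c) = c := by
  have := G.chain_induction R (k := k)
    (S := LinearMap.eqLocus ((G.wordChain R k).comp (G.chainTuple R k)) LinearMap.id)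
    fun x hx => by
      change G.wordChain R k (G.chainTuple R k (G.simplexChain R _)) = _
      rw [G.chainTuple_simplexChain R (G.wordSimplex x hx) hx, simplexTuple_wordSimplex,
        G.wordChain_single R x hx]; rfl
  exact this.ge (Submodule.mem_top (x := c))

lemma chainTuple_wordChain (G : Digraph V) (k : ℕ) (c : Tuples V R k)
    (hc : c ∈ Finsupp.supported R R {x : Fin (k + 1) → V | G.IsInjWord x}) :
    G.chainTuple R k (G.wordChain R k c) = c := by
  rw [Finsupp.supported_eq_span_single] at hc
  refine (Submodule.span_le (p := LinearMap.eqLocus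
    ((G.chainTuple R k).comp (G.wordChain R k)) LinearMap.id)).2 ?_ hc
  rintro _ ⟨x, hx, rfl⟩
  change G.chainTuple R k (G.wordChain R k (Finsupp.single x 1)) = Finsupp.single x 1
  rw [G.wordChain_single R x hx, G.chainTuple_simplexChain R (G.wordSimplex x hx) hx,
    simplexTuple_wordSimplex]

lemma chainTuple_injective (G : Digraph V) (k : ℕ) : Function.Injective (G.chainTuple R k) :=
  Function.LeftInverse.injective (G.wordChain_chainTuple R k)

lemma d_simplexChain (G : Digraph V) {k : ℕ}
    (s : (injectiveNerve G.Reach : SSet.{u}).obj (.op (.mk (k + 1)))) :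
    (G.injNerveComplex R).C.d (k + 1) k (G.simplexChain R s) =
      ∑ i : Fin (k + 2), (-1 : R) ^ (i : ℕ) •
        G.simplexChain R ((injectiveNerve G.Reach : SSet.{u}).δ i s) := by
  have h := congrArg (fun f => f.hom (1 : R))
    (SSet.ιNormalizedChainComplex_d (R := ModuleCat.of R R) _ s)
  refine Eq.trans h ?_
  simp only [ModuleCat.hom_sum, LinearMap.sum_apply]
  refine Finset.sum_congr rfl fun i _ => ?_
  -- The signs on the two sides are scalars from different rings; a parity split turns both into `1`
  -- or `-1`.
  rcases Nat.even_or_odd (i : ℕ) with hi | hi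
  · rw [hi.neg_one_pow, hi.neg_one_pow, one_smul, one_smul]; rfl
  · rw [hi.neg_one_pow, hi.neg_one_pow, neg_smul, neg_smul, one_smul, one_smul]; rfl

/-- Every face of an injective word is an injective word, so no face becomes degenerate and all
terms of the alternating sum survive. -/
lemma chainTuple_d (G : Digraph V) (k : ℕ) (c : (G.injNerveComplex R).C.X (k + 1)) :
    G.chainTuple R k ((G.injNerveComplex R).C.d (k + 1) k c) =
      boundary V R k (G.chainTuple R (k + 1) c) := by
  have := G.chain_induction R (k := k + 1) (S := LinearMap.eqLocus
    ((G.chainTuple R k).comp ((G.injNerveComplex R).C.d (k + 1) k).hom)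
    ((boundary V R k).comp (G.chainTuple R (k + 1)))) fun x hx => by
      change G.chainTuple R k ((G.injNerveComplex R).C.d (k + 1) k (G.simplexChain R _)) =
        boundary V R k (G.chainTuple R (k + 1) (G.simplexChain R _))
      rw [G.chainTuple_simplexChain R (G.wordSimplex x hx) hx, d_simplexChain, map_sum,
        simplexTuple_wordSimplex, boundary_single]
      refine Finset.sum_congr rfl fun i _ => ?_
      have hi : G.IsInjWord (G.simplexTuple
          ((injectiveNerve G.Reach : SSet.{u}).δ i (G.wordSimplex x hx))) :=
        ⟨hx.1.comp Fin.succAbove_right_injective,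
          fun _ _ h => hx.2 _ _ (Fin.strictMono_succAbove i h)⟩
      rw [map_smul, G.chainTuple_simplexChain R _ hi]
      rfl
  exact this.ge (Submodule.mem_top (x := c))

/-- The tuples of length at most `p`. -/
def lenLE (G : Digraph V) (k : ℕ) (p : ℤ) : Set (Fin (k + 1) → V) :=
  {x | ∃ n : ℕ, G.len x ≤ n ∧ (n : ℤ) ≤ p}

/-- The inclusion of `F_p` sends generators to generators, so its image is spanned by the words of
length at most `p`. This translates the filtration into a support condition on tuples. -/
lemma mem_F_iff (G : Digraph V) (p : ℤ) (k : ℕ) (c : (G.injNerveComplex R).C.X k) :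
    c ∈ (G.injNerveComplex R).F p k ↔
      G.chainTuple R k c ∈ Finsupp.supported R R (G.lenLE k p) := by
  have hι : ∀ s, ((SSet.normalizedChainComplexMap (G.injLengthFiltration p).ι
      (ModuleCat.of R R)).f k).hom ((SSet.ιNormalizedChainComplex (R := ModuleCat.of R R)
        (G.injLengthFiltration p : SSet.{u}) s).hom (1 : R)) = G.simplexChain R s.1 := fun s =>
    congrArg (fun f => f.hom (1 : R)) (SSet.ι_normalizedChainComplexMap_f (R := ModuleCat.of R R)
      (G.injLengthFiltration p).ι s)
  constructor
  · rintro ⟨y, rfl⟩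
    have hy := (SSet.span_ιNormalizedChainComplex (R := R)
      (G.injLengthFiltration p : SSet.{u}) k).ge (Submodule.mem_top (x := y))
    refine (Submodule.span_le (p := (Finsupp.supported R R (G.lenLE k p)).comap
      ((G.chainTuple R k).comp ((SSet.normalizedChainComplexMap (G.injLengthFiltration p).ι
      (ModuleCat.of R R)).f k).hom))).2 ?_ hy
    rintro _ ⟨s, rfl⟩
    refine Eq.mpr (congrArg (fun c => G.chainTuple R k c ∈ Finsupp.supported R R (G.lenLE k p))
      (hι s)) ?_
    by_cases hs : G.IsInjWord (G.simplexTuple s.1)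
    · rw [G.chainTuple_simplexChain R _ hs]
      exact Finsupp.single_mem_supported R _ s.2
    · rw [G.simplexChain_eq_zero R _ hs, map_zero]; exact zero_mem _
  · intro h
    have h' : G.chainTuple R k c ∈ Finsupp.supported R R
        ({x | G.IsInjWord x} ∩ G.lenLE k p) := by
      rw [Finsupp.supported_inter]; exact ⟨G.chainTuple_mem R k c, h⟩
    rw [← G.wordChain_chainTuple R k c]
    rw [Finsupp.supported_eq_span_single] at h'
    refine (Submodule.span_le (p := ((G.injNerveComplex R).F p k).comap (G.wordChain R k))).2 ?_ h'
    rintro _ ⟨x, hx, rfl⟩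
    change G.wordChain R k (Finsupp.single x 1) ∈ (G.injNerveComplex R).F p k
    rw [G.wordChain_single R x hx.1]
    exact ⟨_, hι ⟨G.wordSimplex x hx.1, hx.2⟩⟩

lemma tupleComplex_d (M : ∀ k, Submodule R (Tuples V R k))
    (D : ∀ k, Tuples V R (k + 1) →ₗ[R] Tuples V R k) (hD : ∀ k, ∀ c ∈ M (k + 1), D k c ∈ M k)
    (hDD : ∀ k, ∀ c ∈ M (k + 2), D k (D (k + 1) c) = 0) (k : ℕ) :
    (tupleComplex M D hD hDD).d (k + 1) k = ModuleCat.ofHom ((D k).restrict (hD k)) :=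
  ChainComplex.of_d (fun k => ModuleCat.of R (M k))
    (fun k => ModuleCat.ofHom ((D k).restrict (hD k))) k

lemma injWordsIncl_mem (G : Digraph V) (k : ℕ) (c : (G.injWordsComplex R).X k) :
    G.injWordsIncl R k c ∈ Finsupp.supported R R {x : Fin (k + 1) → V | G.IsInjWord x} :=
  Subtype.prop (p := (· ∈ Finsupp.supported R R {x : Fin (k + 1) → V | G.IsInjWord x})) c

lemma injWordsIncl_d (G : Digraph V) (k : ℕ) (c : (G.injWordsComplex R).X (k + 1)) :
    G.injWordsIncl R k ((G.injWordsComplex R).d (k + 1) k c) =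
      boundary V R k (G.injWordsIncl R (k + 1) c) :=
  congrArg (fun f => G.injWordsIncl R k (f.hom c)) (tupleComplex_d R _ _ _ _ k)

/-- The isomorphism between the chains of injective words and the normalized chains of the
injective nerve. -/
noncomputable def wordIso (G : Digraph V) : G.injWordsComplex R ≅ (G.injNerveComplex R).C :=
  HomologicalComplex.Hom.isoOfComponents (fun k => LinearEquiv.toModuleIso
      (LinearEquiv.ofLinearMap (M := (G.injWordsComplex R).X k)
      ((G.wordChain R k).comp (G.injWordsIncl R k))
      ((G.chainTuple R k).codRestrict
        (Finsupp.supported R R {x : Fin (k + 1) → V | G.IsInjWord x}) (G.chainTuple_mem R k))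
      (LinearMap.ext fun c => G.wordChain_chainTuple R k c)
      (LinearMap.ext fun c => Subtype.ext (G.chainTuple_wordChain R k c.1 c.2)))) (by
    rintro _ k rfl
    -- Compatibility with differentials is checked after the injective map `chainTuple`, where both
    -- sides become `boundary`.
    refine ModuleCat.hom_ext (LinearMap.ext fun c => G.chainTuple_injective R k ?_)
    change G.chainTuple R k ((G.injNerveComplex R).C.d (k + 1) k
        (G.wordChain R (k + 1) (G.injWordsIncl R (k + 1) c))) =
      G.chainTuple R k (G.wordChain R k (G.injWordsIncl R k ((G.injWordsComplex R).d (k + 1) k c)))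
    rw [chainTuple_d, G.chainTuple_wordChain R _ _ (G.injWordsIncl_mem R _ c),
      G.chainTuple_wordChain R _ _ (G.injWordsIncl_mem R _ _), injWordsIncl_d])

end Digraph

/-- A description of the homology of a chain complex of modules by cycles modulo boundaries. -/
lemma ChainComplex.exists_homology_iso_quotient {R : Type u} [CommRing R]
    (K : ChainComplex (ModuleCat.{u} R) ℕ) (k : ℕ) {Z : Type u} [AddCommGroup Z] [Module R Z]
    (N : Submodule R Z) (φ : Z →ₗ[R] K.X k) (h₁ : ∀ z j, K.d k j (φ z) = 0)
    (h₂ : ∀ x, (∀ j, K.d k j x = 0) → ∃ z, φ z = x)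
    (h₃ : ∀ z, z ∈ N ↔ ∃ y, K.d (k + 1) k y = φ z) :
    ∃ e : K.homology k ≅ ModuleCat.of R (Z ⧸ N), ∀ (c : K.cycles k) (z : Z),
      K.iCycles k c = φ z → e.hom (K.homologyπ k c) = N.mkQ z := by
  refine ⟨ShortComplex.homologyIsoQuotient (K.sc k) N φ (fun z => h₁ z _) (fun x hx => ?_)
    (fun z => ?_), fun c z h => ShortComplex.homologyIsoQuotient_hom_π (K.sc k) N φ _ _ _ c z h⟩
  -- The hypothesis on `x` concerns only the differential to `next k`; a `j` not related to `k`
  -- contributes the zero map.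
  · obtain ⟨z, hz⟩ := h₂ x fun j => by
      by_cases hj : (ComplexShape.down ℕ).Rel k j
      · have : K.d k ((ComplexShape.down ℕ).next k) x = 0 := hx
        rwa [(ComplexShape.down ℕ).next_eq' hj] at this
      · rw [K.shape _ _ hj]; rfl
    exact ⟨z, 0, by rw [map_zero, add_zero]; exact hz.symm⟩
  · rw [h₃]
    change _ ↔ ∃ y, K.d ((ComplexShape.down ℕ).prev k) k y = φ z
    rw [ChainComplex.prev]

namespace FilteredComplex

variable {R : Type u} [CommRing R] (A : FilteredComplex R)

/-- The differential preserves the filtration. For `r = 0` this describes both terms `Z^0` in `B^1`.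
-/
lemma mem_Z_of_nonpos {r p : ℤ} (hr : r ≤ 0) {k : ℕ} {x : A.C.X k} (hx : x ∈ A.F p k) :
    x ∈ A.Z r p k :=
  ⟨hx, fun j => A.mono (by omega) _ (A.d_mem _ _ _ _ hx)⟩

end FilteredComplex

namespace Digraph

/-! ### Lengths of tuples of distinct vertices -/

section Length

variable {V : Type u} (G : Digraph V)

lemma reachable_of_edist_ne_top {x y : V} (h : G.edist x y ≠ ⊤) : G.Reachable x y :=
  let ⟨n, hn, _⟩ := exists_hasWalk_of_edist_ne_top h
  ⟨n, hn⟩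

lemma isInjWord_of_len_ne_top {k : ℕ} {x : Fin (k + 1) → V} (hx : Function.Injective x)
    (h : G.len x ≠ ⊤) : G.IsInjWord x := by
  refine ⟨hx, fun i j hij => G.reachable_of_edist_ne_top fun htop => h ?_⟩
  -- The pair `(x_i, x_j)` is a subtuple, so its distance is bounded by the finite length of `x`.
  have hle := G.len_comp_le x ![i, j] (by
    refine Fin.monotone_iff_le_succ.2 fun t => ?_
    obtain rfl := Subsingleton.elim t 0
    exact hij.le)
  have hlen : G.len (x ∘ ![i, j]) = G.edist (x i) (x j) := by simp [len]
  rw [hlen, htop] at hle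
  exact top_le_iff.1 hle

lemma IsInjWord.len_ne_top {G : Digraph V} {k : ℕ} {x : Fin (k + 1) → V} (hx : G.IsInjWord x) :
    G.len x ≠ ⊤ := by
  refine (WithTop.sum_lt_top.2 fun i _ => ?_).ne
  obtain ⟨n, hn⟩ := hx.2 _ _ (Fin.castSucc_lt_succ (i := i))
  exact (edist_le hn).trans_lt (WithTop.coe_lt_top n)

lemma one_le_edist {x y : V} (h : x ≠ y) : 1 ≤ G.edist x y :=
  Order.one_le_iff_ne_zero.2 (edist_ne_zero h)

lemma adj_of_edist_le_one {x y : V} (h : x ≠ y) (hle : G.edist x y ≤ 1) : G.Adj x y := by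
  obtain ⟨n, hn, en⟩ := exists_hasWalk_of_edist_ne_top
    (hle.trans_lt (WithTop.coe_lt_top 1)).ne
  have h1 := le_antisymm hle (G.one_le_edist h)
  rw [en] at h1
  obtain rfl : n = 1 := by exact_mod_cast h1
  cases hn with
  | cons e w => cases w; exact e

lemma edist_le_one_of_adj {x y : V} (h : G.Adj x y) : G.edist x y ≤ 1 := by
  simpa using edist_le (HasWalk.cons h (.nil y))

lemma one_le_edist_succ {k : ℕ} {x : Fin (k + 1) → V} (hx : Function.Injective x) (i : Fin k) :
    1 ≤ G.edist (x i.castSucc) (x i.succ) :=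
  G.one_le_edist fun h => Fin.castSucc_lt_succ.ne (hx h)

lemma le_len {k : ℕ} {x : Fin (k + 1) → V} (hx : Function.Injective x) : (k : ℕ∞) ≤ G.len x := by
  calc (k : ℕ∞) = ∑ _ : Fin k, 1 := by simp
    _ ≤ G.len x := Finset.sum_le_sum fun i _ => G.one_le_edist_succ hx i

/-- Each of the `k` steps between distinct vertices has length at least one, so total length at most
`k` forces every step to be an edge. -/
lemma isStronglyRegularPath_iff {k : ℕ} {x : Fin (k + 1) → V} :
    G.IsStronglyRegularPath x ↔ Function.Injective x ∧ G.len x ≤ k := by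
  refine ⟨fun hx => ⟨hx.1, ?_⟩, fun ⟨hx, hlen⟩ => ⟨hx, fun i => ?_⟩⟩
  · calc G.len x ≤ ∑ _ : Fin k, 1 := Finset.sum_le_sum fun i _ => G.edist_le_one_of_adj (hx.2 i)
      _ = k := by simp
  · refine G.adj_of_edist_le_one (fun h => Fin.castSucc_lt_succ.ne (hx h)) ?_
    by_contra hcon
    have h2 : (1 + 1 : ℕ∞) ≤ G.edist (x i.castSucc) (x i.succ) :=
      Order.add_one_le_of_lt (not_le.1 hcon)
    have : (k : ℕ∞) + 1 ≤ k := by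
      -- A single step of length at least two pushes the total above `k`.
      calc (k : ℕ∞) + 1 = ∑ j : Fin k, (1 + if j = i then 1 else 0) := by
            simp [Finset.sum_add_distrib]
        _ ≤ G.len x := Finset.sum_le_sum fun j _ => by
            split_ifs with hj
            · rw [hj]; exact h2
            · simpa using G.one_le_edist_succ hx j
        _ ≤ k := hlen
    norm_cast at this
    omega

lemma mem_lenLE_natCast {k l : ℕ} {x : Fin (k + 1) → V} : x ∈ G.lenLE k l ↔ G.len x ≤ l :=
  ⟨fun ⟨_, hn, hl⟩ => hn.trans (by exact_mod_cast hl), fun h => ⟨l, h, le_rfl⟩⟩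

lemma mem_lenLE_sub_one {k l : ℕ} {x : Fin (k + 1) → V} :
    x ∈ G.lenLE k (l - 1) ↔ G.len x < l := by
  constructor
  · rintro ⟨n, hn, hl⟩
    exact hn.trans_lt (by exact_mod_cast (by omega : n < l))
  · intro h
    obtain ⟨n, hn⟩ := ENat.ne_top_iff_exists.1 (h.trans (WithTop.coe_lt_top l)).ne
    rw [← hn] at h
    have : n < l := by exact_mod_cast h
    exact ⟨n, hn.ge, by omega⟩

lemma lenLE_mono (k : ℕ) : Monotone (G.lenLE k) :=
  fun _ _ h _ ⟨n, hn, hp⟩ => ⟨n, hn, hp.trans h⟩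

/-- There are finitely many `(k+1)`-tuples, and injective words have finite length; `toNat` assigns
the remaining tuples a harmless value. -/
lemma exists_forall_mem_lenLE [Finite V] (k : ℕ) :
    ∃ p : ℤ, ∀ x : Fin (k + 1) → V, G.IsInjWord x → x ∈ G.lenLE k p := by
  obtain ⟨N, hN⟩ := (Set.finite_range fun x : Fin (k + 1) → V => (G.len x).toNat).bddAbove
  exact ⟨N, fun x hx => ⟨(G.len x).toNat, (ENat.natCast_toNat hx.len_ne_top).ge,
    by exact_mod_cast hN ⟨x, rfl⟩⟩⟩

end Length

variable {V : Type u} (R : Type u) [CommRing R] (G : Digraph V)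

/-! ### The part of length `l` of a chain of tuples -/

section LenProj

lemma lenProj_apply (l k : ℕ) (c : Tuples V R k) (x : Fin (k + 1) → V)
    [Decidable (G.len x = l)] : G.lenProj R l k c x = if G.len x = l then c x else 0 := by
  classical
  induction c using Finsupp.induction_linear with
  | zero => simp
  | add c c' hc hc' => rw [map_add, Finsupp.add_apply, hc, hc']; split_ifs <;> simp
  | single y a =>
    rw [← mul_one a, ← smul_eq_mul, ← Finsupp.smul_single, map_smul, lenProj_single]
    by_cases hxy : y = x
    · subst hxy; split_ifs <;> simp
    · split_ifs <;> simp [Finsupp.single_eq_of_ne' hxy]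

variable {R G}

lemma lenProj_eq_zero {l k : ℕ} {c : Tuples V R k}
    (hc : c ∈ Finsupp.supported R R (G.lenLE k (l - 1))) : G.lenProj R l k c = 0 := by
  classical
  ext x
  rw [lenProj_apply]
  split_ifs with h
  · exact Finsupp.notMem_support_iff.1 fun hx => (G.mem_lenLE_sub_one.1 (hc hx)).ne h
  · rfl

lemma mem_supported_of_lenProj_eq_zero {l k : ℕ} {c : Tuples V R k}
    (hc : c ∈ Finsupp.supported R R (G.lenLE k l)) (h : G.lenProj R l k c = 0) :
    c ∈ Finsupp.supported R R (G.lenLE k (l - 1)) := by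
  classical
  intro x hx
  refine G.mem_lenLE_sub_one.2 (lt_of_le_of_ne (G.mem_lenLE_natCast.1 (hc hx)) fun hl => ?_)
  have := G.lenProj_apply R l k c x
  rw [h, if_pos hl] at this
  exact Finsupp.mem_support_iff.1 hx this.symm

lemma lenProj_mem_eulerianChains {l k : ℕ} {c : Tuples V R k}
    (hc : c ∈ Finsupp.supported R R {x : Fin (k + 1) → V | G.IsInjWord x}) :
    G.lenProj R l k c ∈ G.eulerianChains R l k := by
  classical
  intro x hx
  have h := Finsupp.mem_support_iff.1 hx
  rw [lenProj_apply] at h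
  split_ifs at h with hl
  · exact ⟨(hc (Finsupp.mem_support_iff.2 h)).1, hl⟩
  · exact (h rfl).elim

lemma lenProj_of_mem_eulerianChains {l k : ℕ} {c : Tuples V R k}
    (hc : c ∈ G.eulerianChains R l k) : G.lenProj R l k c = c := by
  classical
  ext x
  rw [lenProj_apply]
  split_ifs with h
  · rfl
  · exact (Finsupp.notMem_support_iff.1 fun hx => h (hc hx).2).symm

lemma eulerianChains_le_lenLE (l k : ℕ) :
    G.eulerianChains R l k ≤ Finsupp.supported R R (G.lenLE k l) :=
  Finsupp.supported_mono fun _ hx => G.mem_lenLE_natCast.2 hx.2.le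

lemma eulerianChains_le_injWords (l k : ℕ) : G.eulerianChains R l k ≤
    Finsupp.supported R R {x : Fin (k + 1) → V | G.IsInjWord x} :=
  Finsupp.supported_mono fun _ hx =>
    G.isInjWord_of_len_ne_top hx.1 (hx.2 ▸ WithTop.coe_ne_top)

lemma supported_lenLE_natCast (k l : ℕ) : Finsupp.supported R R (G.lenLE k l) =
    Finsupp.supported R R {x : Fin (k + 1) → V | G.len x ≤ l} :=
  congrArg _ (Set.ext fun _ => G.mem_lenLE_natCast)

end LenProj

lemma chain_mem_F_iff {p : ℤ} {k : ℕ} {c : Tuples V R k}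
    (hc : c ∈ Finsupp.supported R R {x : Fin (k + 1) → V | G.IsInjWord x}) :
    G.wordChain R k c ∈ (G.injNerveComplex R).F p k ↔
      c ∈ Finsupp.supported R R (G.lenLE k p) := by
  rw [mem_F_iff, chainTuple_wordChain _ _ _ _ hc]

/-! ### The first page and eulerian magnitude homology -/

section Euler

/-- The part of length `l` of an element of `Z^1_l`. -/
noncomputable def leadingPart (l k : ℕ) :
    (G.injNerveComplex R).Z 1 l k →ₗ[R] (G.eulerianMagnitudeComplex R l).X k :=
  (((G.lenProj R l k).comp (G.chainTuple R k)).comp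
    ((G.injNerveComplex R).Z 1 l k).subtype).codRestrict (G.eulerianChains R l k)
      fun z => lenProj_mem_eulerianChains (G.chainTuple_mem R k z.1)

lemma eulerianIncl_leadingPart (l k : ℕ) (z : (G.injNerveComplex R).Z 1 l k) :
    G.eulerianIncl R l k (G.leadingPart R l k z) = G.lenProj R l k (G.chainTuple R k z.1) := rfl

lemma eulerianIncl_mem (l k : ℕ) (c : (G.eulerianMagnitudeComplex R l).X k) :
    G.eulerianIncl R l k c ∈ G.eulerianChains R l k :=
  Subtype.prop (p := (· ∈ G.eulerianChains R l k)) c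

lemma eulerianIncl_injective (l k : ℕ) : Function.Injective (G.eulerianIncl R l k) :=
  Subtype.val_injective (p := (· ∈ G.eulerianChains R l k))

lemma exists_eulerianIncl_eq {l k : ℕ} {c : Tuples V R k} (hc : c ∈ G.eulerianChains R l k) :
    ∃ x, G.eulerianIncl R l k x = c := ⟨(⟨c, hc⟩ : G.eulerianChains R l k), rfl⟩

lemma eulerianIncl_d (l k : ℕ) (c : (G.eulerianMagnitudeComplex R l).X (k + 1)) :
    G.eulerianIncl R l k ((G.eulerianMagnitudeComplex R l).d (k + 1) k c) =
      G.lenProj R l k (boundary V R k (G.eulerianIncl R l (k + 1) c)) := by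
  rw [← G.magnitudeBoundary_eq R l k _ (G.eulerianIncl_mem R l (k + 1) c)]
  exact congrArg (fun f => G.eulerianIncl R l k (f.hom c)) (tupleComplex_d R _ _ _ _ k)

/-- The magnitude differential is the length `l` part of the full boundary; when it vanishes, the
boundary drops from `F_l` to `F_{l-1}`. -/
lemma wordChain_mem_Z_one {l k : ℕ} (c : (G.eulerianMagnitudeComplex R l).X k)
    (hc : ∀ j, (G.eulerianMagnitudeComplex R l).d k j c = 0) :
    G.wordChain R k (G.eulerianIncl R l k c) ∈ (G.injNerveComplex R).Z 1 l k := by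
  have hw := eulerianChains_le_injWords _ _ (G.eulerianIncl_mem R l k c)
  have hF := (G.chain_mem_F_iff R hw).2 (eulerianChains_le_lenLE _ _ (G.eulerianIncl_mem R l k c))
  refine ⟨hF, fun j => ?_⟩
  by_cases hj : j + 1 = k
  · subst hj
    have hd := (G.injNerveComplex R).d_mem _ _ j _ hF
    rw [mem_F_iff] at hd ⊢
    refine mem_supported_of_lenProj_eq_zero hd ?_
    rw [chainTuple_d, G.chainTuple_wordChain R _ _ hw, ← eulerianIncl_d, hc, map_zero]
  · rw [(G.injNerveComplex R).C.shape _ _ hj]; exact zero_mem _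

lemma leadingPart_wordChain {l k : ℕ} (c : (G.eulerianMagnitudeComplex R l).X k)
    (hc : G.wordChain R k (G.eulerianIncl R l k c) ∈ (G.injNerveComplex R).Z 1 l k) :
    G.leadingPart R l k ⟨_, hc⟩ = c := by
  apply G.eulerianIncl_injective R
  rw [eulerianIncl_leadingPart, G.chainTuple_wordChain R _ _
    (eulerianChains_le_injWords _ _ (G.eulerianIncl_mem R l k c)),
    lenProj_of_mem_eulerianChains (G.eulerianIncl_mem R l k c)]

lemma d_leadingPart (l k : ℕ) (z : (G.injNerveComplex R).Z 1 l k) (j : ℕ) :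
    (G.eulerianMagnitudeComplex R l).d k j (G.leadingPart R l k z) = 0 := by
  by_cases hj : j + 1 = k
  · subst hj
    apply G.eulerianIncl_injective R
    have h1 := (G.mem_F_iff R _ _ _).1 z.2.1
    have h2 := (G.mem_F_iff R _ _ _).1 (z.2.2 j)
    rw [supported_lenLE_natCast] at h1
    rw [eulerianIncl_d, eulerianIncl_leadingPart, G.lenProj_boundary_lenProj R l j _ h1,
      ← chainTuple_d, lenProj_eq_zero h2, map_zero]
  · rw [(G.eulerianMagnitudeComplex R l).shape _ _ hj]; rfl

/-- Modulo `F_{l-1}`, only length `l` parts matter: if `z = a + dw` then the length `l` part of `w`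
bounds that of `z`, and conversely, if `y` bounds the leading part of `z`, then `z - dy` lies in
`F_{l-1}`. -/
lemma mem_B_one_iff (l k : ℕ) (z : (G.injNerveComplex R).Z 1 l k) :
    z.1 ∈ (G.injNerveComplex R).B 1 l k ↔
      ∃ y, (G.eulerianMagnitudeComplex R l).d (k + 1) k y = G.leadingPart R l k z := by
  constructor
  · intro hz
    obtain ⟨a, ha, _, ⟨w, hw, rfl⟩, haw⟩ := Submodule.mem_sup.1 hz
    change a + (G.injNerveComplex R).C.d (k + 1) k w = z.1 at haw
    obtain ⟨y, hy⟩ := G.exists_eulerianIncl_eq R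
      (lenProj_mem_eulerianChains (l := l) (G.chainTuple_mem R (k + 1) w))
    refine ⟨y, G.eulerianIncl_injective R l k ?_⟩
    have h1 := (G.mem_F_iff R _ _ _).1 hw.1
    rw [add_sub_cancel_right, supported_lenLE_natCast] at h1
    rw [eulerianIncl_d, hy, G.lenProj_boundary_lenProj R l k _ h1, ← chainTuple_d,
      eulerianIncl_leadingPart, ← haw, map_add, map_add,
      lenProj_eq_zero ((G.mem_F_iff R _ _ _).1 ha.1), zero_add]
  · rintro ⟨y, hy⟩
    have hw := eulerianChains_le_injWords _ _ (G.eulerianIncl_mem R l (k + 1) y)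
    have hF := (G.chain_mem_F_iff R hw).2
      (eulerianChains_le_lenLE _ _ (G.eulerianIncl_mem R l (k + 1) y))
    set w := G.wordChain R (k + 1) (G.eulerianIncl R l (k + 1) y) with hw_def
    have ha : z.1 - (G.injNerveComplex R).C.d (k + 1) k w ∈ (G.injNerveComplex R).F (l - 1) k := by
      have h1 := sub_mem z.2.1 ((G.injNerveComplex R).d_mem _ _ k _ hF)
      rw [mem_F_iff] at h1 ⊢
      refine mem_supported_of_lenProj_eq_zero h1 ?_
      rw [map_sub, map_sub, chainTuple_d, hw_def, G.chainTuple_wordChain R _ _ hw,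
        ← eulerianIncl_d, hy, eulerianIncl_leadingPart, sub_self]
    rw [← sub_add_cancel z.1 ((G.injNerveComplex R).C.d (k + 1) k w)]
    refine add_mem (Submodule.mem_sup_left ((G.injNerveComplex R).mem_Z_of_nonpos (by simp) ha))
      (Submodule.mem_sup_right ⟨w, (G.injNerveComplex R).mem_Z_of_nonpos (by simp) ?_, rfl⟩)
    rwa [add_sub_cancel_right]

/-- The first page is the eulerian magnitude homology. -/
theorem exists_eulerianMagnitudeHomology_iso (k l : ℕ) :
    ∃ e : G.eulerianMagnitudeHomology R k l ≅
        ModuleCat.of R ((G.injNerveComplex R).E 1 l k),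
      ∀ z : (G.eulerianMagnitudeComplex R l).cycles k,
        ∃ w : (G.injNerveComplex R).Z 1 l k,
          w.1 = G.wordChain R k
            (G.eulerianIncl R l k ((G.eulerianMagnitudeComplex R l).iCycles k z)) ∧
          e.hom ((G.eulerianMagnitudeComplex R l).homologyπ k z) =
            (G.injNerveComplex R).cls 1 l k w := by
  obtain ⟨e, he⟩ := (G.eulerianMagnitudeComplex R l).exists_homology_iso_quotient k
    (((G.injNerveComplex R).B 1 l k).comap ((G.injNerveComplex R).Z 1 l k).subtype)
    (G.leadingPart R l k) (G.d_leadingPart R l k)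
    (fun x hx => ⟨_, G.leadingPart_wordChain R x (G.wordChain_mem_Z_one R x hx)⟩)
    (G.mem_B_one_iff R l k)
  refine ⟨e, fun z => ⟨⟨_, G.wordChain_mem_Z_one R _ fun j =>
    ChainComplex.d_iCycles _ k j z⟩, rfl, he z _ ?_⟩⟩
  rw [leadingPart_wordChain]

end Euler

/-! ### The diagonal of the second page and regular path homology -/

section PathHomology

lemma mem_F_diag_iff (k : ℕ) (c : (G.injNerveComplex R).C.X k) :
    c ∈ (G.injNerveComplex R).F k k ↔ G.chainTuple R k c ∈ G.stronglyRegularPaths R k := by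
  rw [mem_F_iff]
  constructor
  · intro h x hx
    exact G.isStronglyRegularPath_iff.2
      ⟨(G.chainTuple_mem R k c hx).1, G.mem_lenLE_natCast.1 (h hx)⟩
  · intro h x hx
    exact G.mem_lenLE_natCast.2 (G.isStronglyRegularPath_iff.1 (h hx)).2

lemma F_eq_bot {p : ℤ} {k : ℕ} (h : p < k) : (G.injNerveComplex R).F p k = ⊥ := by
  refine (Submodule.eq_bot_iff _).2 fun c hc => G.chainTuple_injective R k ?_
  rw [map_zero, ← Finsupp.support_eq_empty, Finset.eq_empty_iff_forall_notMem]
  intro x hx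
  have h1 := G.mem_lenLE_sub_one.1
    (G.lenLE_mono k (by omega : p ≤ k - 1) ((G.mem_F_iff R _ _ _).1 hc hx))
  exact absurd (G.le_len (G.chainTuple_mem R k c hx).1) (not_le.2 h1)

lemma stronglyRegularPaths_le_injWords (k : ℕ) : G.stronglyRegularPaths R k ≤
    Finsupp.supported R R {x : Fin (k + 1) → V | G.IsInjWord x} :=
  Finsupp.supported_mono fun _ hx => G.isInjWord_of_len_ne_top hx.1
    ((G.isStronglyRegularPath_iff.1 hx).2.trans_lt (WithTop.coe_lt_top k)).ne

lemma regularOmega_le (k : ℕ) : G.regularOmega R k ≤ G.stronglyRegularPaths R k := by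
  cases k with
  | zero => exact le_rfl
  | succ k => exact inf_le_left

/-- The differential lands in `F_{k-2}` in chain degree `k - 1`, below the minimal length of a word
in that degree. -/
lemma d_eq_zero_of_mem_Z_two {k : ℕ} {c : (G.injNerveComplex R).C.X k}
    (hc : c ∈ (G.injNerveComplex R).Z 2 k k) (j : ℕ) : (G.injNerveComplex R).C.d k j c = 0 := by
  by_cases hj : j + 1 = k
  · have := hc.2 j
    rwa [G.F_eq_bot R (by omega), Submodule.mem_bot] at this
  · rw [(G.injNerveComplex R).C.shape _ _ hj]; rfl

/-- On the diagonal, the two conditions defining `Z^1` are those defining `Ω`: the chain lies in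
`F_k C_k` and its boundary in `F_{k-1} C_{k-1}`, both spanned by strongly regular paths. -/
lemma chainTuple_mem_regularOmega {k : ℕ} {c : (G.injNerveComplex R).C.X k}
    (hc : c ∈ (G.injNerveComplex R).Z 1 k k) : G.chainTuple R k c ∈ G.regularOmega R k := by
  have h1 := (G.mem_F_diag_iff R k c).1 hc.1
  cases k with
  | zero => exact h1
  | succ k =>
    refine ⟨h1, ?_⟩
    have h2 := hc.2 k
    rw [show ((k + 1 : ℕ) : ℤ) - 1 = k by omega, mem_F_diag_iff, chainTuple_d] at h2
    exact h2

/-- The path given by an element of `Z^2_k` in degree `k`. -/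
noncomputable def regularPathOfZ (k : ℕ) :
    (G.injNerveComplex R).Z 2 k k →ₗ[R] (G.regularPathComplex R).X k :=
  ((G.chainTuple R k).comp ((G.injNerveComplex R).Z 2 k k).subtype).codRestrict
    (G.regularOmega R k) fun z => G.chainTuple_mem_regularOmega R
      ((G.injNerveComplex R).Z_mono le_rfl (by omega) k z.2)

lemma regularPathIncl_regularPathOfZ (k : ℕ) (z : (G.injNerveComplex R).Z 2 k k) :
    G.regularPathIncl R k (G.regularPathOfZ R k z) = G.chainTuple R k z.1 := rfl

lemma regularPathIncl_mem (k : ℕ) (c : (G.regularPathComplex R).X k) :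
    G.regularPathIncl R k c ∈ G.regularOmega R k :=
  Subtype.prop (p := (· ∈ G.regularOmega R k)) c

lemma regularPathIncl_injective (k : ℕ) : Function.Injective (G.regularPathIncl R k) :=
  Subtype.val_injective (p := (· ∈ G.regularOmega R k))

lemma exists_regularPathIncl_eq {k : ℕ} {c : Tuples V R k} (hc : c ∈ G.regularOmega R k) :
    ∃ x, G.regularPathIncl R k x = c := ⟨(⟨c, hc⟩ : G.regularOmega R k), rfl⟩

lemma regularPathIncl_d (k : ℕ) (c : (G.regularPathComplex R).X (k + 1)) :
    G.regularPathIncl R k ((G.regularPathComplex R).d (k + 1) k c) =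
      boundary V R k (G.regularPathIncl R (k + 1) c) :=
  congrArg (fun f => G.regularPathIncl R k (f.hom c)) (tupleComplex_d R _ _ _ _ k)

lemma chainTuple_wordChain_regularPathIncl (k : ℕ) (c : (G.regularPathComplex R).X k) :
    G.chainTuple R k (G.wordChain R k (G.regularPathIncl R k c)) = G.regularPathIncl R k c :=
  G.chainTuple_wordChain R _ _
    (G.stronglyRegularPaths_le_injWords R k (G.regularOmega_le R k (G.regularPathIncl_mem R k c)))

lemma wordChain_regularPathIncl_mem_F (k : ℕ) (c : (G.regularPathComplex R).X k) :
    G.wordChain R k (G.regularPathIncl R k c) ∈ (G.injNerveComplex R).F k k := by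
  rw [mem_F_diag_iff, chainTuple_wordChain_regularPathIncl]
  exact G.regularOmega_le R k (G.regularPathIncl_mem R k c)

lemma wordChain_d (k : ℕ) (c : (G.regularPathComplex R).X (k + 1)) :
    G.wordChain R k (G.regularPathIncl R k ((G.regularPathComplex R).d (k + 1) k c)) =
      (G.injNerveComplex R).C.d (k + 1) k
        (G.wordChain R (k + 1) (G.regularPathIncl R (k + 1) c)) := by
  apply G.chainTuple_injective R
  rw [chainTuple_wordChain_regularPathIncl, chainTuple_d, chainTuple_wordChain_regularPathIncl,
    regularPathIncl_d]

lemma wordChain_mem_Z_two {k : ℕ} (c : (G.regularPathComplex R).X k)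
    (hc : ∀ j, (G.regularPathComplex R).d k j c = 0) :
    G.wordChain R k (G.regularPathIncl R k c) ∈ (G.injNerveComplex R).Z 2 k k := by
  refine (G.injNerveComplex R).mem_Z_of_d_eq_zero (G.wordChain_regularPathIncl_mem_F R k c)
    (fun j => ?_) 2
  by_cases hj : j + 1 = k
  · subst hj
    rw [← wordChain_d, hc, map_zero, map_zero]
  · rw [(G.injNerveComplex R).C.shape _ _ hj]; rfl

lemma regularPathOfZ_wordChain {k : ℕ} (c : (G.regularPathComplex R).X k)
    (hc : G.wordChain R k (G.regularPathIncl R k c) ∈ (G.injNerveComplex R).Z 2 k k) :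
    G.regularPathOfZ R k ⟨_, hc⟩ = c := by
  apply G.regularPathIncl_injective R
  rw [regularPathIncl_regularPathOfZ, chainTuple_wordChain_regularPathIncl]

lemma d_regularPathOfZ (k : ℕ) (z : (G.injNerveComplex R).Z 2 k k) (j : ℕ) :
    (G.regularPathComplex R).d k j (G.regularPathOfZ R k z) = 0 := by
  by_cases hj : j + 1 = k
  · subst hj
    apply G.regularPathIncl_injective R
    rw [regularPathIncl_d, regularPathIncl_regularPathOfZ, ← chainTuple_d,
      G.d_eq_zero_of_mem_Z_two R z.2, map_zero, map_zero]
  · rw [(G.regularPathComplex R).shape _ _ hj]; rfl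

lemma mem_B_two_iff (k : ℕ) (z : (G.injNerveComplex R).Z 2 k k) :
    z.1 ∈ (G.injNerveComplex R).B 2 k k ↔
      ∃ y, (G.regularPathComplex R).d (k + 1) k y = G.regularPathOfZ R k z := by
  constructor
  · intro hz
    obtain ⟨a, ha, _, ⟨w, hw, rfl⟩, haw⟩ := Submodule.mem_sup.1 hz
    change a + (G.injNerveComplex R).C.d (k + 1) k w = z.1 at haw
    -- The summand `a` lies in `F_{k-1} C_k = 0`, so `z` is the boundary of an element of
    -- `Z^1_{k+1}`, that is, of `Ω_{k+1}`.
    have ha := ha.1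
    rw [G.F_eq_bot R (by omega), Submodule.mem_bot] at ha
    rw [ha, zero_add] at haw
    obtain ⟨y, hy⟩ := G.exists_regularPathIncl_eq R (G.chainTuple_mem_regularOmega R
      ((G.injNerveComplex R).Z_mono (by omega) (by omega) (k + 1) hw))
    refine ⟨y, G.regularPathIncl_injective R k ?_⟩
    rw [regularPathIncl_d, hy, regularPathIncl_regularPathOfZ, ← haw, chainTuple_d]
  · rintro ⟨y, hy⟩
    have hz : z.1 = (G.injNerveComplex R).C.d (k + 1) k
        (G.wordChain R (k + 1) (G.regularPathIncl R (k + 1) y)) := by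
      apply G.chainTuple_injective R
      rw [← regularPathIncl_regularPathOfZ, ← hy, ← wordChain_d,
        chainTuple_wordChain_regularPathIncl]
    -- The bounding path lies in `F_{k+1} C_{k+1}`, and its boundary is `z`, which lies in `F_k`;
    -- this is membership in `Z^1_{k+1}`.
    refine Submodule.mem_sup_right ⟨_, ⟨(G.injNerveComplex R).mono (by omega) _
      (G.wordChain_regularPathIncl_mem_F R (k + 1) y), fun j => ?_⟩, hz.symm⟩
    by_cases hj : j = k
    · subst hj
      rw [← hz]
      exact (G.injNerveComplex R).mono (by omega) _ z.2.1
    · rw [(G.injNerveComplex R).C.shape _ _ (by simp [ComplexShape.down]; omega)]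
      exact zero_mem _

/-- The diagonal of the second page is the regular path homology. -/
theorem exists_regularPathHomology_iso (k : ℕ) :
    ∃ e : G.regularPathHomology R k ≅ ModuleCat.of R ((G.injNerveComplex R).E 2 k k),
      ∀ z : (G.regularPathComplex R).cycles k,
        ∃ w : (G.injNerveComplex R).Z 2 k k,
          w.1 = G.wordChain R k (G.regularPathIncl R k ((G.regularPathComplex R).iCycles k z)) ∧
          e.hom ((G.regularPathComplex R).homologyπ k z) = (G.injNerveComplex R).cls 2 k k w := by
  obtain ⟨e, he⟩ := (G.regularPathComplex R).exists_homology_iso_quotient k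
    (((G.injNerveComplex R).B 2 k k).comap ((G.injNerveComplex R).Z 2 k k).subtype)
    (G.regularPathOfZ R k) (G.d_regularPathOfZ R k)
    (fun x hx => ⟨_, G.regularPathOfZ_wordChain R x (G.wordChain_mem_Z_two R x hx)⟩)
    (G.mem_B_two_iff R k)
  refine ⟨e, fun z => ⟨⟨_, G.wordChain_mem_Z_two R _ fun j =>
    ChainComplex.d_iCycles _ k j z⟩, rfl, he z _ ?_⟩⟩
  rw [regularPathOfZ_wordChain]

end PathHomology

/-! ### Convergence to the homology of the complex of injective words -/

section Convergence

lemma wordIso_hom_f (k : ℕ) (c : (G.injWordsComplex R).X k) :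
    (G.wordIso R).hom.f k c = G.wordChain R k (G.injWordsIncl R k c) := rfl

lemma mem_injWordsHomologyFiltration_iff (k : ℕ) (p : ℤ) (h : (G.injWordsComplex R).homology k) :
    h ∈ G.injWordsHomologyFiltration R k p ↔ ∃ c : (G.injWordsComplex R).cycles k,
      (G.wordIso R).hom.f k ((G.injWordsComplex R).iCycles k c) ∈ (G.injNerveComplex R).F p k ∧
        (G.injWordsComplex R).homologyπ k c = h := by
  refine exists_congr fun c => and_congr_left fun _ => ?_
  rw [wordIso_hom_f, G.chain_mem_F_iff R (G.injWordsIncl_mem R k _)]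
  rfl

lemma exists_F_eq_top [Finite V] (k : ℕ) : ∃ p, (G.injNerveComplex R).F p k = ⊤ := by
  obtain ⟨p, hp⟩ := G.exists_forall_mem_lenLE k
  refine ⟨p, Submodule.eq_top_iff'.2 fun c => (G.mem_F_iff R _ _ _).2 ?_⟩
  exact Finsupp.supported_mono hp (G.chainTuple_mem R k c)

/-- The regular magnitude-path spectral sequence converges to the homology of the complex of
injective words. -/
theorem convergesTo_injWordsHomology [Finite V] :
    ConvergesTo (G.regularMagnitudePathSS R) (fun k => (G.injWordsComplex R).homology k)
      (G.injWordsHomologyFiltration R) :=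
  FilteredComplex.convergesTo (G.wordIso R) (G.mem_injWordsHomologyFiltration_iff R)
    (G.exists_F_eq_top R)

end Convergence

end Digraph

theorem mainTheorem2 {V R : Type u} [Finite V] [CommRing R] (G : Digraph V) :
    -- the first page is the eulerian magnitude homology
    (∀ k l : ℕ, ∃ e : G.eulerianMagnitudeHomology R k l ≅
        ((G.regularMagnitudePathSS R).page 1).X (l, k),
      ∀ z : (G.eulerianMagnitudeComplex R l).cycles k,
        ∃ w : (G.injNerveComplex R).Z 1 l k,
          w.1 = G.wordChain R k
            (G.eulerianIncl R l k ((G.eulerianMagnitudeComplex R l).iCycles k z)) ∧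
          e.hom ((G.eulerianMagnitudeComplex R l).homologyπ k z) =
            (G.injNerveComplex R).cls 1 l k w) ∧
    -- the diagonal of the second page is the regular path homology
    (∀ k : ℕ, ∃ e : G.regularPathHomology R k ≅ ((G.regularMagnitudePathSS R).page 2).X (k, k),
      ∀ z : (G.regularPathComplex R).cycles k,
        ∃ w : (G.injNerveComplex R).Z 2 k k,
          w.1 = G.wordChain R k (G.regularPathIncl R k ((G.regularPathComplex R).iCycles k z)) ∧
          e.hom ((G.regularPathComplex R).homologyπ k z) = (G.injNerveComplex R).cls 2 k k w) ∧
    -- the filtered complex computes the homology of the complex of injective words, to which the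
    -- spectral sequence converges
    ((∃ θ : G.injWordsComplex R ≅ (G.injNerveComplex R).C,
        ∀ (k : ℕ) (c : (G.injWordsComplex R).X k),
          θ.hom.f k c = G.wordChain R k (G.injWordsIncl R k c)) ∧
      ConvergesTo (G.regularMagnitudePathSS R) (fun k => (G.injWordsComplex R).homology k)
        (G.injWordsHomologyFiltration R)) ∧
    -- the inclusions of the filtration steps induce a map to the magnitude-path spectral sequence
    (∃ φ : G.regularMagnitudePathSS R ⟶ G.magnitudePathSS R,
      ∀ (r : ℤ) (hr : 0 ≤ r) (l k : ℕ) (w : (G.injNerveComplex R).Z r l k),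
        (φ.hom r hr).f (l, k) ((G.injNerveComplex R).cls r l k w) =
          (G.nerveComplex R).cls r l k ((G.inclusionHom R).mapZ r l k w)) := by
  exact ⟨G.exists_eulerianMagnitudeHomology_iso R, G.exists_regularPathHomology_iso R,
    ⟨⟨G.wordIso R, G.wordIso_hom_f R⟩, G.convergesTo_injWordsHomology R⟩,
    (G.inclusionHom R).mapSpectralSequence, fun _ _ _ _ _ => rfl⟩
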